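/- Let $D_-=\{(x,y,z): x^2+(y+1)^2\le 1,\ z=0\}$ and $D_+=\{(x,y,z): (y-1)^2+z^2\le 1,\ x=0\}$ be two disks in $\mathbb{R}^3$, and let $\Omega$ be the convex hull of $D_-\cup D_+$. The mean width $MW$ of $\Omega$ is the average, over $v$ uniformly distributed on the unit sphere, of the distance $w(v)$ between the two supporting planes of $\Omega$ orthogonal to $v$. An exterior unit normal of $\Omega$ at $p$ is a unit vector $n$ with $n\cdot(q-p)\le 0$ for all $q\in\Omega$. For $0\le u\le 1$, $-2\le v\le -\tfrac23$ let $$X(u,v)=\left(u\sqrt{-v(2+v)},\ \frac{v(1+2uv)}{1+2v},\ \frac{(-1+u)\sqrt{v(2+3v)}}{1+2v}\right),$$ and for signs $s,t\in\{1,-1\}$ let $X_{s,t}=(s\,x,\,y,\,t\,z)$ be its mirror images, with oriented unit normal $n_{s,t}=st\,\dfrac{(X_{s,t})_u\times(X_{s,t})_v}{|(X_{s,t})_u\times(X_{s,t})_v|}$. With $E,F,G$ the coefficients of the first fundamental form, and $L=X_u\cdot n_u$, $M=\frac12(X_u\cdot n_v+X_v\cdot n_u)$, $N=X_v\cdot n_v$,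 the mean curvature is $H=\dfrac{EN-2FM+GL}{2(EG-F^2)}$ (the average of the principal curvatures, nonnegative for convex bodies), and $dS=\sqrt{EG-F^2}\,du\,dv$. Then: 1. $D_-\cap D_+=\{0\}$. 2. $w$ is integrable on the sphere, and $MW=\sqrt2+\operatorname{arcsec}(3)=2.6451729797138697309366179\ldots$ 3. For all signs $s,t$, $X_{s,t}$ maps $[0,1]\times[-2,-\frac23]$ onto $\partial\Omega\cap\{sx\ge0,\ tz\ge0\}$, it is injective on $(0,1)\times(-2,-\frac23)$, and for $0\le u\le1$, $-2<v<-\frac23$ the vector $n_{s,t}(u,v)$ is an exterior unit normal of $\Omega$ at $X_{s,t}(u,v)$. 4. $H\,dS$ is integrable on each patch, and the integrated mean curvature, summed over the four patches, is $\displaystyle\int_{\partial\Omega}H\,dS=2\sqrt2\,\pi$. 5. For each sign $s$, the curve $v\mapsto X_{s,1}(1,v)$, $-2\le v\le-\frac23$, traces the arc $x^2+(y+1)^2=1$, $z=0$, $sx\ge 0$, $y\le-\frac23$; for each sign $t$, the curve $v\mapsto X_{1,t}(0,v)$ traces the arc $(y-1)^2+z^2=1$, $x=0$, $tz\ge0$,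 $y\ge\frac23$. At every point of $\partial\Omega$ outside these four edges, $\Omega$ has exactly one exterior unit normal. 6. Let $\alpha$ be the exterior dihedral angle along an edge, i.e. the angle between the exterior normals $n_{s,1}$ and $n_{s,-1}$ (along $u=1$), respectively $n_{1,t}$ and $n_{-1,t}$ (along $u=0$), and let $ds$ be arclength. Then $\alpha\,ds$ is integrable on each edge $\varepsilon_1,\dots,\varepsilon_4$, and with $\varepsilon$ the edge in $z=0$, $x\ge0$, $$4\int_{\varepsilon}\alpha\,ds=\sum_{j=1}^4\int_{\varepsilon_j}\alpha\,ds=4\pi\operatorname{arcsec}(3).$$ 7. $\displaystyle MW=\frac1{2\pi}\int_{\partial\Omega}H\,dS+\frac1{4\pi}\sum_{j=1}^4\int_{\varepsilon_j}\alpha\,ds.$ -/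

import Mathlib

open MeasureTheory Set

namespace TwoDisks

noncomputable section

/-! Euclidean 3-space, width and mean width. -/

/-- Euclidean three-space; the coordinates `x, y, z` are `p 0, p 1, p 2`. -/
abbrev E3 : Type := EuclideanSpace ℝ (Fin 3)

/-- The point with coordinates `(x, y, z)`. -/
def mk3 (x y z : ℝ) : E3 := !₂[x, y, z]

/-- Width of `K` in the unit direction `v`: the distance between the two supporting planes of `K`
that are orthogonal to `v`. -/
def width (K : Set E3) (v : E3) : ℝ :=
  sSup ((fun p : E3 => inner ℝ v p) '' K) - sInf ((fun p : E3 => inner ℝ v p) '' K)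

/-- Mean width of `K`: the average of the width over the unit sphere, with respect to the
(normalized) surface measure of the sphere. -/
def meanWidth (K : Set E3) : ℝ :=
  ⨍ v : Metric.sphere (0 : E3) 1, width K (v : E3) ∂((volume : Measure E3).toSphere)

/-- The inverse secant. -/
def arcsec (x : ℝ) : ℝ := Real.arccos x⁻¹

/-! The convex body. -/

/-- The disk `x² + (y + 1)² ≤ 1, z = 0`. -/
def diskMinus : Set E3 := {p | p 0 ^ 2 + (p 1 + 1) ^ 2 ≤ 1 ∧ p 2 = 0}

/-- The disk `(y - 1)² + z² ≤ 1, x = 0`. -/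
def diskPlus : Set E3 := {p | (p 1 - 1) ^ 2 + p 2 ^ 2 ≤ 1 ∧ p 0 = 0}

/-- The convex hull of the two disks. -/
def body : Set E3 := convexHull ℝ (diskMinus ∪ diskPlus)

/-- `n` is an exterior unit normal vector of `K` at `p`: it has length one, and `K` lies in the
half-space bounded by the plane through `p` orthogonal to `n` and opposite to `n`. -/
def IsExteriorUnitNormal (K : Set E3) (p n : E3) : Prop :=
  ‖n‖ = 1 ∧ ∀ q ∈ K, inner ℝ n (q - p) ≤ 0

/-! Differential geometry of a parametrized surface `X(u, v)` with a field `n(u, v)` of unit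
normals. -/

/-- The cross product on `E3`. -/
def cross (a b : E3) : E3 := WithLp.toLp 2 (crossProduct (WithLp.ofLp a) (WithLp.ofLp b))

/-- Partial derivative with respect to the first parameter. -/
def partialU (X : ℝ → ℝ → E3) (u v : ℝ) : E3 := deriv (fun t => X t v) u

/-- Partial derivative with respect to the second parameter. -/
def partialV (X : ℝ → ℝ → E3) (u v : ℝ) : E3 := deriv (fun t => X u t) v

/-- The unit normal `(X_u × X_v) / |X_u × X_v|`. -/
def unitNormal (X : ℝ → ℝ → E3) (u v : ℝ) : E3 :=
  ‖cross (partialU X u v) (partialV X u v)‖⁻¹ • cross (partialU X u v) (partialV X u v)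

/-- First fundamental form, `E = X_u · X_u`. -/
def ffE (X : ℝ → ℝ → E3) (u v : ℝ) : ℝ := inner ℝ (partialU X u v) (partialU X u v)

/-- First fundamental form, `F = X_u · X_v`. -/
def ffF (X : ℝ → ℝ → E3) (u v : ℝ) : ℝ := inner ℝ (partialU X u v) (partialV X u v)

/-- First fundamental form, `G = X_v · X_v`. -/
def ffG (X : ℝ → ℝ → E3) (u v : ℝ) : ℝ := inner ℝ (partialV X u v) (partialV X u v)

/-- Second fundamental form, `L = X_u · n_u`. With `n` the exterior normal this sign makes the
principal curvatures of a convex body nonnegative. -/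
def sfL (X n : ℝ → ℝ → E3) (u v : ℝ) : ℝ := inner ℝ (partialU X u v) (partialU n u v)

/-- Second fundamental form, `M = (X_u · n_v + X_v · n_u) / 2`. -/
def sfM (X n : ℝ → ℝ → E3) (u v : ℝ) : ℝ :=
  (inner ℝ (partialU X u v) (partialV n u v) + inner ℝ (partialV X u v) (partialU n u v)) / 2

/-- Second fundamental form, `N = X_v · n_v`. -/
def sfN (X n : ℝ → ℝ → E3) (u v : ℝ) : ℝ := inner ℝ (partialV X u v) (partialV n u v)

/-- The mean curvature `H`: the average of the two principal curvatures. -/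
def meanCurvature (X n : ℝ → ℝ → E3) (u v : ℝ) : ℝ :=
  (ffE X u v * sfN X n u v - 2 * ffF X u v * sfM X n u v + ffG X u v * sfL X n u v) /
    (2 * (ffE X u v * ffG X u v - ffF X u v ^ 2))

/-- The area density: `dS = √(EG - F²) du dv`. -/
def areaDensity (X : ℝ → ℝ → E3) (u v : ℝ) : ℝ :=
  Real.sqrt (ffE X u v * ffG X u v - ffF X u v ^ 2)

/-! The parametrization of the boundary by four mirror-image patches. -/

/-- The parametrization of the part of the boundary in `x ≥ 0, z ≥ 0`, for `0 ≤ u ≤ 1` and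
`-2 ≤ v ≤ -2/3`. -/
def vinzant (u v : ℝ) : E3 :=
  mk3 (u * Real.sqrt (-v * (2 + v)))
    (v * (1 + 2 * u * v) / (1 + 2 * v))
    ((-1 + u) * Real.sqrt (v * (2 + 3 * v)) / (1 + 2 * v))

/-- The real number `1` or `-1` given by a sign. -/
def sgn (s : ℤˣ) : ℝ := ((s : ℤ) : ℝ)

/-- The mirror image `(s x, y, t z)` of the parametrization, for signs `s, t`. -/
def patch (s t : ℤˣ) (u v : ℝ) : E3 :=
  mk3 (sgn s * vinzant u v 0) (vinzant u v 1) (sgn t * vinzant u v 2)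

/-- The unit normal of the patch, oriented by the sign `s t` (a reflection reverses the
orientation of the cross product). -/
def patchNormal (s t : ℤˣ) (u v : ℝ) : E3 :=
  (sgn s * sgn t) • unitNormal (patch s t) u v

/-- The closed parameter rectangle. -/
def closedRect : Set (ℝ × ℝ) := Icc (0 : ℝ) 1 ×ˢ Icc (-2 : ℝ) (-2 / 3)

/-- The open parameter rectangle. -/
def openRect : Set (ℝ × ℝ) := Ioo (0 : ℝ) 1 ×ˢ Ioo (-2 : ℝ) (-2 / 3)

/-- `H dS` on a patch, as a density in the parameters. -/
def curvatureDensity (s t : ℤˣ) (q : ℝ × ℝ) : ℝ :=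
  meanCurvature (patch s t) (patchNormal s t) q.1 q.2 * areaDensity (patch s t) q.1 q.2

/-- The integrated mean curvature `∫ H dS` over the four patches. -/
def integratedMeanCurvature : ℝ :=
  ∑ s : ℤˣ, ∑ t : ℤˣ, ∫ q in openRect, curvatureDensity s t q

/-! The four edges. -/

/-- The edge `u = 1` between the patches `(s, 1)` and `(s, -1)`. -/
def edgeMinus (s : ℤˣ) : Set E3 := (fun v => patch s 1 1 v) '' Icc (-2 : ℝ) (-2 / 3)

/-- The edge `u = 0` between the patches `(1, t)` and `(-1, t)`. -/
def edgePlus (t : ℤˣ) : Set E3 := (fun v => patch 1 t 0 v) '' Icc (-2 : ℝ) (-2 / 3)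

/-- `α ds` on the edge `edgeMinus s`: the exterior dihedral angle, i.e. the angle between the
exterior normals of the two adjacent patches, times the arclength density. -/
def edgeMinusDensity (s : ℤˣ) (v : ℝ) : ℝ :=
  InnerProductGeometry.angle (patchNormal s 1 1 v) (patchNormal s (-1) 1 v) *
    ‖deriv (fun r => patch s 1 1 r) v‖

/-- `α ds` on the edge `edgePlus t`. -/
def edgePlusDensity (t : ℤˣ) (v : ℝ) : ℝ :=
  InnerProductGeometry.angle (patchNormal 1 t 0 v) (patchNormal (-1) t 0 v) *
    ‖deriv (fun r => patch 1 t 0 r) v‖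

/-- The edge term: the sum of `∫ α ds` over the four edges. -/
def edgeTerm : ℝ :=
  (∑ s : ℤˣ, ∫ v in Ioo (-2 : ℝ) (-2 / 3), edgeMinusDensity s v) +
    (∑ t : ℤˣ, ∫ v in Ioo (-2 : ℝ) (-2 / 3), edgePlusDensity t v)

end

end TwoDisks

/-!
The support functions of the two disks are, for a vector `n = (a, b, c)`,
`h₋(n) = √(a² + b²) - b` and `h₊(n) = √(b² + c²) + b`, and that of the convex hull is their maximum.

*The boundary.* A supporting plane exists at each boundary point
(`exists_isExteriorUnitNormal`), and a boundary point is a point of one of the disks or lies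
strictly between the disks. In the latter case the supporting plane touches both disks
(`support_of_mem_openSegment`), so `h₋(n) = h₊(n)`, and the points of contact determine each other
and the direction of `n` (`coords_of_common_support`). With `v` the `y`-coordinate of the point of
contact on the first circle this direction is `N(v) = (±√(-v (2 + v)), 1 + v, ±√(v (2 + 3 v)))`,
called `ruleNormal`, and the segments between the points of contact are the rulings of the patches.
Boundary points in one of the disks lie on the four edges (`frontier_cases`).

*Curvature.* The normal is constant along the rulings, so of the second fundamental form only the
coefficient `N` survives. With `a = √(-v (2 + v))` and `c = √(v (2 + 3 v))` one finds
`H dS = 3 v² / (a c |N(v)|²) du dv` (`curvatureDensity_eq`), which has the antiderivative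
`arcsin (3 (1 + v) / |N(v)|) / √2`.

*Edges.* Along the first circle `α = 2 arctan c` and `ds = dv / a`. The integral is rationalized by
`v = -(2 + 2 s²) / (3 + s²)`, and after writing the arctangent as an integral over `0 < k < 1` the
order of integration is exchanged. The integral over `s` is elementary (`integral_sq_div`), and the
integral over `k` has an arcsine as antiderivative. The second circle leads to the same integral.

*Mean width.* Support functions are positively homogeneous, so the average over the sphere becomes
an integral over the ball, and the isometry that exchanges the disks reduces it to the region where
`h₋ > h₊` (`integral_supp_eq`). In cylindrical coordinates this region is bounded by the cone
`|z| = ρ √(v (2 + 3 v))` with `v = cos θ - 1`, and integration over `z` and `ρ` leaves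
`MW = (2 / π) ∫ -v (arctan c + c / (1 + c²)) / a dv` over `-2 < v < -2/3`. The integrand is the
sum of the curvature density, half the edge density, and the derivative of a function that vanishes
at both ends (`hasDerivAt_widthPrimitive`); this is the reason for the
formula that expresses the mean width by the integrated mean curvature and the edge term.
-/

namespace TwoDisks

/-! ### Support functions and width -/

lemma inner_E3 (v p : E3) : inner ℝ v p = v 0 * p 0 + v 1 * p 1 + v 2 * p 2 := by
  simp [PiLp.inner_apply, Fin.sum_univ_three]
  ring

lemma norm_sq_E3 (v : E3) : ‖v‖ ^ 2 = v 0 ^ 2 + v 1 ^ 2 + v 2 ^ 2 := by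
  rw [← real_inner_self_eq_norm_sq, inner_E3]
  ring

@[simp] lemma mk3_zero (x y z : ℝ) : mk3 x y z 0 = x := rfl
@[simp] lemma mk3_one (x y z : ℝ) : mk3 x y z 1 = y := rfl
@[simp] lemma mk3_two (x y z : ℝ) : mk3 x y z 2 = z := rfl

lemma ext_E3 {p q : E3} (h0 : p 0 = q 0) (h1 : p 1 = q 1) (h2 : p 2 = q 2) : p = q := by
  ext i
  fin_cases i <;> assumption

/-- The support function of `diskMinus`. -/
noncomputable def suppMinus (n : E3) : ℝ := Real.sqrt (n 0 ^ 2 + n 1 ^ 2) - n 1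

/-- The support function of `diskPlus`. -/
noncomputable def suppPlus (n : E3) : ℝ := Real.sqrt (n 1 ^ 2 + n 2 ^ 2) + n 1

/-- The support function of `body`. -/
noncomputable def supp (n : E3) : ℝ := max (suppMinus n) (suppPlus n)

/-- The Cauchy–Schwarz inequality in the plane, for a vector of length at most one. -/
lemma planar_inner_le {a b x y : ℝ} (h : x ^ 2 + y ^ 2 ≤ 1) :
    a * x + b * y ≤ Real.sqrt (a ^ 2 + b ^ 2) := by
  apply Real.le_sqrt_of_sq_le
  nlinarith [sq_nonneg (a * y - b * x),
    mul_le_mul_of_nonneg_left h (by positivity : 0 ≤ a ^ 2 + b ^ 2)]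

/-- Equality in the planar Cauchy–Schwarz inequality. -/
lemma planar_inner_eq {a b x y : ℝ} (h : x ^ 2 + y ^ 2 ≤ 1)
    (he : a * x + b * y = Real.sqrt (a ^ 2 + b ^ 2)) :
    a = Real.sqrt (a ^ 2 + b ^ 2) * x ∧ b = Real.sqrt (a ^ 2 + b ^ 2) * y := by
  set r := Real.sqrt (a ^ 2 + b ^ 2) with hr
  have h2 : r ^ 2 = a ^ 2 + b ^ 2 := Real.sq_sqrt (by positivity)
  have h3 : (a - r * x) ^ 2 + (b - r * y) ^ 2 ≤ 0 := by
    have h4 : r * (a * x + b * y) = r ^ 2 := by rw [he, sq]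
    nlinarith [mul_le_mul_of_nonneg_left h (sq_nonneg r)]
  constructor
  · nlinarith [sq_nonneg (a - r * x), sq_nonneg (b - r * y)]
  · nlinarith [sq_nonneg (a - r * x), sq_nonneg (b - r * y)]

/-- A planar vector has a unit vector in its direction (any unit vector if it vanishes). -/
lemma exists_planar_unit (a b : ℝ) :
    ∃ x y : ℝ, x ^ 2 + y ^ 2 = 1 ∧ a * x + b * y = Real.sqrt (a ^ 2 + b ^ 2) := by
  rcases (Real.sqrt_nonneg (a ^ 2 + b ^ 2)).eq_or_lt with h | h
  · refine ⟨1, 0, by norm_num, ?_⟩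
    have := (Real.sqrt_eq_zero (by positivity)).1 h.symm
    rw [← h]
    nlinarith [sq_nonneg a, sq_nonneg b]
  · set r := Real.sqrt (a ^ 2 + b ^ 2) with hr
    have h2 : r ^ 2 = a ^ 2 + b ^ 2 := Real.sq_sqrt (by positivity)
    refine ⟨a / r, b / r, ?_, ?_⟩
    · field_simp
      linarith
    · field_simp
      linarith

lemma inner_le_suppMinus (n : E3) {p : E3} (hp : p ∈ diskMinus) : inner ℝ n p ≤ suppMinus n := by
  obtain ⟨h1, h2⟩ := hp
  have := planar_inner_le (a := n 0) (b := n 1) h1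
  rw [inner_E3, suppMinus, h2]
  linarith

lemma inner_le_suppPlus (n : E3) {p : E3} (hp : p ∈ diskPlus) : inner ℝ n p ≤ suppPlus n := by
  obtain ⟨h1, h2⟩ := hp
  have := planar_inner_le (a := n 1) (b := n 2) h1
  rw [inner_E3, suppPlus, h2]
  linarith

lemma exists_inner_eq_suppMinus (n : E3) : ∃ p ∈ diskMinus, inner ℝ n p = suppMinus n := by
  obtain ⟨x, y, h1, h2⟩ := exists_planar_unit (n 0) (n 1)
  refine ⟨mk3 x (y - 1) 0, ⟨by simpa using h1.le, rfl⟩, ?_⟩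
  rw [inner_E3, suppMinus, ← h2]
  simp
  ring

lemma exists_inner_eq_suppPlus (n : E3) : ∃ p ∈ diskPlus, inner ℝ n p = suppPlus n := by
  obtain ⟨x, y, h1, h2⟩ := exists_planar_unit (n 1) (n 2)
  refine ⟨mk3 0 (x + 1) y, ⟨by simpa using h1.le, rfl⟩, ?_⟩
  rw [inner_E3, suppPlus, ← h2]
  simp
  ring

lemma diskMinus_subset_body : diskMinus ⊆ body :=
  subset_union_left.trans (subset_convexHull ℝ _)

lemma diskPlus_subset_body : diskPlus ⊆ body :=
  subset_union_right.trans (subset_convexHull ℝ _)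

lemma inner_le_supp (n : E3) {p : E3} (hp : p ∈ body) : inner ℝ n p ≤ supp n := by
  have hconv : Convex ℝ {q : E3 | inner ℝ n q ≤ supp n} :=
    convex_halfSpace_le (innerₛₗ ℝ n).isLinear _
  refine convexHull_min ?_ hconv hp
  rintro q (hq | hq)
  · exact (inner_le_suppMinus n hq).trans (le_max_left _ _)
  · exact (inner_le_suppPlus n hq).trans (le_max_right _ _)

lemma exists_inner_eq_supp (n : E3) : ∃ p ∈ body, inner ℝ n p = supp n := by
  rcases max_choice (suppMinus n) (suppPlus n) with h | h
  · obtain ⟨p, hp, he⟩ := exists_inner_eq_suppMinus n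
    exact ⟨p, diskMinus_subset_body hp, he.trans h.symm⟩
  · obtain ⟨p, hp, he⟩ := exists_inner_eq_suppPlus n
    exact ⟨p, diskPlus_subset_body hp, he.trans h.symm⟩

lemma isGreatest_inner_body (n : E3) :
    IsGreatest ((fun p : E3 => inner ℝ n p) '' body) (supp n) := by
  refine ⟨exists_inner_eq_supp n, ?_⟩
  rintro _ ⟨p, hp, rfl⟩
  exact inner_le_supp n hp

lemma isLeast_inner_body (n : E3) :
    IsLeast ((fun p : E3 => inner ℝ n p) '' body) (-supp (-n)) := by
  constructor
  · obtain ⟨p, hp, he⟩ := exists_inner_eq_supp (-n)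
    refine ⟨p, hp, ?_⟩
    rw [← he]
    simp
  · rintro _ ⟨p, hp, rfl⟩
    have := inner_le_supp (-n) hp
    rw [inner_neg_left] at this
    simpa using neg_le.1 this

lemma width_body (n : E3) : width body n = supp n + supp (-n) := by
  rw [width, (isGreatest_inner_body n).csSup_eq, (isLeast_inner_body n).csInf_eq]
  ring

lemma continuous_suppMinus : Continuous suppMinus := by
  unfold suppMinus; fun_prop

lemma continuous_suppPlus : Continuous suppPlus := by
  unfold suppPlus; fun_prop

lemma continuous_supp : Continuous supp :=
  continuous_suppMinus.max continuous_suppPlus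

lemma continuous_width_body : Continuous (width body) := by
  have : width body = fun n => supp n + supp (-n) := funext width_body
  rw [this]
  exact continuous_supp.add (continuous_supp.comp continuous_neg)

lemma integrable_width_body :
    Integrable (fun v : Metric.sphere (0 : E3) 1 => width body (v : E3))
      ((volume : Measure E3).toSphere) :=
  (continuous_width_body.comp continuous_subtype_val).integrable_of_hasCompactSupport
    (HasCompactSupport.of_compactSpace _)

lemma diskMinus_inter_diskPlus : diskMinus ∩ diskPlus = {0} := by
  ext p
  simp only [diskMinus, diskPlus, mem_inter_iff, mem_ofPred_eq, mem_singleton_iff]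
  constructor
  · rintro ⟨⟨h1, h2⟩, h3, h4⟩
    rw [h4] at h1
    rw [h2] at h3
    refine ext_E3 h4 ?_ h2
    change p 1 = 0
    nlinarith
  · rintro rfl
    simp

/-! ### Supporting normals -/

lemma isExteriorUnitNormal_iff {p n : E3} (hp : p ∈ body) :
    IsExteriorUnitNormal body p n ↔ ‖n‖ = 1 ∧ inner ℝ n p = supp n := by
  refine and_congr_right fun _ => ⟨fun h => ?_, fun h q hq => ?_⟩
  · obtain ⟨q, hq, he⟩ := exists_inner_eq_supp n
    have := h q hq
    rw [inner_sub_right] at this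
    exact le_antisymm (inner_le_supp n hp) (by linarith)
  · rw [inner_sub_right, h]
    linarith [inner_le_supp n hq]

lemma convex_diskMinus : Convex ℝ diskMinus := by
  intro p hp q hq s t hs ht hst
  obtain ⟨h1, h2⟩ := hp
  obtain ⟨h3, h4⟩ := hq
  refine ⟨?_, by simp [h2, h4]⟩
  obtain rfl : t = 1 - s := by linarith
  simp only [PiLp.add_apply, PiLp.smul_apply, smul_eq_mul]
  nlinarith [mul_nonneg hs ht, sq_nonneg (p 0 - q 0), sq_nonneg (p 1 - q 1),
    mul_nonneg (mul_nonneg hs ht) (add_nonneg (sq_nonneg (p 0 - q 0)) (sq_nonneg (p 1 - q 1))),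
    mul_le_mul_of_nonneg_left h1 hs, mul_le_mul_of_nonneg_left h3 ht]

lemma convex_diskPlus : Convex ℝ diskPlus := by
  intro p hp q hq s t hs ht hst
  obtain ⟨h1, h2⟩ := hp
  obtain ⟨h3, h4⟩ := hq
  refine ⟨?_, by simp [h2, h4]⟩
  obtain rfl : t = 1 - s := by linarith
  simp only [PiLp.add_apply, PiLp.smul_apply, smul_eq_mul]
  nlinarith [mul_nonneg hs ht,
    mul_nonneg (mul_nonneg hs ht) (add_nonneg (sq_nonneg (p 2 - q 2)) (sq_nonneg (p 1 - q 1))),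
    mul_le_mul_of_nonneg_left h1 hs, mul_le_mul_of_nonneg_left h3 ht]

lemma mem_body_iff {p : E3} :
    p ∈ body ↔ ∃ d ∈ diskMinus, ∃ e ∈ diskPlus, ∃ r ∈ Icc (0 : ℝ) 1,
      p = r • d + (1 - r) • e := by
  have h0 : (0 : E3) ∈ diskMinus ∩ diskPlus := by rw [diskMinus_inter_diskPlus]; rfl
  rw [body, convexHull_union ⟨0, h0.1⟩ ⟨0, h0.2⟩, convex_diskMinus.convexHull_eq,
    convex_diskPlus.convexHull_eq]
  simp only [mem_convexJoin, segment, mem_ofPred_eq]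
  constructor
  · rintro ⟨d, hd, e, he, s, t, hs, ht, hst, rfl⟩
    exact ⟨d, hd, e, he, s, ⟨hs, by linarith⟩, by rw [← hst, add_sub_cancel_left]⟩
  · rintro ⟨d, hd, e, he, r, hr, rfl⟩
    exact ⟨d, hd, e, he, r, 1 - r, hr.1, by linarith [hr.2], by ring, rfl⟩

lemma isCompact_diskMinus : IsCompact diskMinus := by
  refine Metric.isCompact_of_isClosed_isBounded ?_ ?_
  · have h : IsClosed ({p : E3 | p 0 ^ 2 + (p 1 + 1) ^ 2 ≤ 1} ∩ {p | p 2 = 0}) :=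
      (isClosed_le (by fun_prop) (by fun_prop)).inter (isClosed_eq (by fun_prop) (by fun_prop))
    exact h
  · refine (Metric.isBounded_iff_subset_closedBall 0).2 ⟨3, fun p hp => ?_⟩
    obtain ⟨h1, h2⟩ := hp
    rw [mem_closedBall_zero_iff]
    refine abs_le_of_sq_le_sq' ?_ (by norm_num) |>.2
    rw [norm_sq_E3, h2]
    nlinarith [sq_nonneg (p 0)]

lemma isCompact_diskPlus : IsCompact diskPlus := by
  refine Metric.isCompact_of_isClosed_isBounded ?_ ?_
  · have h : IsClosed ({p : E3 | (p 1 - 1) ^ 2 + p 2 ^ 2 ≤ 1} ∩ {p | p 0 = 0}) :=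
      (isClosed_le (by fun_prop) (by fun_prop)).inter (isClosed_eq (by fun_prop) (by fun_prop))
    exact h
  · refine (Metric.isBounded_iff_subset_closedBall 0).2 ⟨3, fun p hp => ?_⟩
    obtain ⟨h1, h2⟩ := hp
    rw [mem_closedBall_zero_iff]
    refine abs_le_of_sq_le_sq' ?_ (by norm_num) |>.2
    rw [norm_sq_E3, h2]
    nlinarith [sq_nonneg (p 2)]

lemma isClosed_body : IsClosed body := by
  have himage : body = (fun x : ℝ × E3 × E3 => x.1 • x.2.1 + (1 - x.1) • x.2.2) ''
      (Icc (0 : ℝ) 1 ×ˢ diskMinus ×ˢ diskPlus) := by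
    ext p
    rw [mem_body_iff]
    constructor
    · rintro ⟨d, hd, e, he, r, hr, rfl⟩
      exact ⟨(r, d, e), ⟨hr, hd, he⟩, rfl⟩
    · rintro ⟨⟨r, d, e⟩, ⟨hr, hd, he⟩, rfl⟩
      exact ⟨d, hd, e, he, r, hr, rfl⟩
  rw [himage]
  exact ((isCompact_Icc.prod (isCompact_diskMinus.prod isCompact_diskPlus)).image
    (by fun_prop)).isClosed

lemma convex_body : Convex ℝ body := convex_convexHull ℝ _

/-- Supporting planes exist at boundary points. If `n · p < supp n` for all unit vectors `n`, then
by compactness of the sphere the gap is at least some `δ > 0`, and then no plane can separate a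
point of the `δ`-ball around `p` from `body`. -/
lemma exists_isExteriorUnitNormal {p : E3} (hp : p ∈ frontier body) :
    ∃ n, IsExteriorUnitNormal body p n := by
  have hpb : p ∈ body := isClosed_body.frontier_subset hp
  by_contra! hno
  have hcomp : IsCompact (Metric.sphere (0 : E3) 1) := isCompact_sphere _ _
  obtain ⟨m, hm, hmin⟩ := hcomp.exists_isMinOn (f := fun n => supp n - inner ℝ n p)
    (NormedSpace.sphere_nonempty.2 zero_le_one)
    ((continuous_supp.sub (by fun_prop)).continuousOn)
  have hm1 : ‖m‖ = 1 := by simpa using hm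
  have hδ : 0 < supp m - inner ℝ m p := by
    have h1 := inner_le_supp m hpb
    have h2 : inner ℝ m p ≠ supp m := fun h =>
      hno m ((isExteriorUnitNormal_iff hpb).2 ⟨hm1, h⟩)
    have := lt_of_le_of_ne h1 h2
    linarith
  refine hp.2 (mem_interior_iff_mem_nhds.2
    (Filter.mem_of_superset (Metric.ball_mem_nhds p hδ) fun q hq => ?_))
  by_contra hqb
  obtain ⟨f, u, hfu, huq⟩ := geometric_hahn_banach_closed_point convex_body isClosed_body hqb
  set n₀ : E3 := (InnerProductSpace.toDual ℝ E3).symm f with hn₀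
  have hf : ∀ x, f x = inner ℝ n₀ x := fun x => by
    rw [hn₀, InnerProductSpace.toDual_symm_apply]
  have hlt : ∀ x ∈ body, inner ℝ n₀ x < inner ℝ n₀ q := fun x hx => by
    rw [← hf, ← hf]
    exact (hfu x hx).trans huq
  have hn₀0 : 0 < ‖n₀‖ := by
    rw [norm_pos_iff]
    intro h
    have := hlt p hpb
    simp [h] at this
  set n : E3 := ‖n₀‖⁻¹ • n₀ with hn
  have hn1 : ‖n‖ = 1 := by
    rw [hn, norm_smul, norm_inv, norm_norm, inv_mul_cancel₀ hn₀0.ne']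
  obtain ⟨x, hx, hxs⟩ := exists_inner_eq_supp n
  have h1 : inner ℝ n x < inner ℝ n q := by
    rw [hn, real_inner_smul_left, real_inner_smul_left]
    exact mul_lt_mul_of_pos_left (hlt x hx) (by positivity)
  have h2 : inner ℝ n (q - p) ≤ ‖q - p‖ := by
    simpa [hn1] using real_inner_le_norm n (q - p)
  rw [inner_sub_right] at h2
  have h3 : ‖q - p‖ < supp m - inner ℝ m p := by
    rwa [Metric.mem_ball, dist_eq_norm] at hq
  have h4 : supp m - inner ℝ m p ≤ supp n - inner ℝ n p := hmin (by simpa using hn1)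
  linarith

/-- A point of `body` with an exterior unit normal lies on the boundary. -/
lemma mem_frontier_of_isExteriorUnitNormal {p n : E3} (hp : p ∈ body)
    (h : IsExteriorUnitNormal body p n) : p ∈ frontier body := by
  refine ⟨subset_closure hp, fun hint => ?_⟩
  obtain ⟨ε, hε, hball⟩ := Metric.mem_nhds_iff.1 (mem_interior_iff_mem_nhds.1 hint)
  have hmem : p + (ε / 2) • n ∈ body := by
    apply hball
    rw [Metric.mem_ball, dist_eq_norm, add_sub_cancel_left, norm_smul, h.1, mul_one,
      Real.norm_of_nonneg (by positivity)]
    linarith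
  have := h.2 _ hmem
  rw [add_sub_cancel_left, real_inner_smul_right, real_inner_self_eq_norm_sq, h.1] at this
  linarith

/-! ### The boundary of the convex hull -/

/-- The part of the circle bounding `diskMinus` that is extreme in `body`. -/
def arcMinus : Set E3 := {p | p 0 ^ 2 + (p 1 + 1) ^ 2 = 1 ∧ p 2 = 0 ∧ p 1 ≤ -2 / 3}

/-- The part of the circle bounding `diskPlus` that is extreme in `body`. -/
def arcPlus : Set E3 := {p | (p 1 - 1) ^ 2 + p 2 ^ 2 = 1 ∧ p 0 = 0 ∧ 2 / 3 ≤ p 1}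

lemma coords_of_inner_eq_suppMinus {n d : E3} (hd : d ∈ diskMinus)
    (h : inner ℝ n d = suppMinus n) :
    n 0 = Real.sqrt (n 0 ^ 2 + n 1 ^ 2) * d 0 ∧
      n 1 = Real.sqrt (n 0 ^ 2 + n 1 ^ 2) * (d 1 + 1) := by
  rw [inner_E3, suppMinus, hd.2] at h
  exact planar_inner_eq hd.1 (by linarith)

lemma coords_of_inner_eq_suppPlus {n e : E3} (he : e ∈ diskPlus)
    (h : inner ℝ n e = suppPlus n) :
    n 1 = Real.sqrt (n 1 ^ 2 + n 2 ^ 2) * (e 1 - 1) ∧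
      n 2 = Real.sqrt (n 1 ^ 2 + n 2 ^ 2) * e 2 := by
  rw [inner_E3, suppPlus, he.2] at h
  exact planar_inner_eq he.1 (by linarith)

/-- A contact point of `diskMinus` with a plane supporting `body` lies on the bounding circle. With
`n = (a, b, c)`, `suppPlus n ≤ suppMinus n` reads `√(b² + c²) + b ≤ √(a² + b²) - b`, hence
`3 b ≤ √(a² + b²)`, which bounds its `y`-coordinate. -/
lemma mem_arcMinus {n d : E3} (hn : n ≠ 0) (hd : d ∈ diskMinus)
    (h : inner ℝ n d = suppMinus n) (hle : suppPlus n ≤ suppMinus n) : d ∈ arcMinus := by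
  obtain ⟨h0, h1⟩ := coords_of_inner_eq_suppMinus hd h
  set r := Real.sqrt (n 0 ^ 2 + n 1 ^ 2) with hr
  have hr0 : 0 ≤ r := Real.sqrt_nonneg _
  have hr2 : r ^ 2 = n 0 ^ 2 + n 1 ^ 2 := Real.sq_sqrt (by positivity)
  have hs0 := Real.sqrt_nonneg (n 1 ^ 2 + n 2 ^ 2)
  have hs2 : Real.sqrt (n 1 ^ 2 + n 2 ^ 2) ^ 2 = n 1 ^ 2 + n 2 ^ 2 := Real.sq_sqrt (by positivity)
  rw [suppPlus, suppMinus, ← hr] at hle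
  set s := Real.sqrt (n 1 ^ 2 + n 2 ^ 2) with hs
  have hpos : 0 < r := by
    rcases hr0.eq_or_lt with h' | h'
    · exfalso
      rw [← h', zero_mul] at h0 h1
      have h2 : n 2 = 0 := by
        have : s = 0 := by linarith
        rw [this] at hs2
        nlinarith
      exact hn (ext_E3 h0 h1 h2)
    · exact h'
  have hsb : n 1 ≤ s := by nlinarith [sq_nonneg (n 2)]
  refine ⟨?_, hd.2, ?_⟩
  · have : r ^ 2 * (d 0 ^ 2 + (d 1 + 1) ^ 2 - 1) = 0 := by
      have e0 : n 0 ^ 2 = (r * d 0) ^ 2 := by rw [← h0]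
      have e1 : n 1 ^ 2 = (r * (d 1 + 1)) ^ 2 := by rw [← h1]
      linarith
    rcases mul_eq_zero.1 this with h' | h'
    · exact absurd h' (by positivity)
    · linarith
  -- `3 n 1 ≤ r`, while `n 1 = r * (d 1 + 1)`.
  · by_contra! hlt
    have : r * (1 / 3) < r * (d 1 + 1) := mul_lt_mul_of_pos_left (by linarith) hpos
    linarith

lemma mem_arcPlus {n e : E3} (hn : n ≠ 0) (he : e ∈ diskPlus)
    (h : inner ℝ n e = suppPlus n) (hle : suppMinus n ≤ suppPlus n) : e ∈ arcPlus := by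
  obtain ⟨h1, h2⟩ := coords_of_inner_eq_suppPlus he h
  set r := Real.sqrt (n 1 ^ 2 + n 2 ^ 2) with hr
  have hr0 : 0 ≤ r := Real.sqrt_nonneg _
  have hr2 : r ^ 2 = n 1 ^ 2 + n 2 ^ 2 := Real.sq_sqrt (by positivity)
  have hs0 := Real.sqrt_nonneg (n 0 ^ 2 + n 1 ^ 2)
  have hs2 : Real.sqrt (n 0 ^ 2 + n 1 ^ 2) ^ 2 = n 0 ^ 2 + n 1 ^ 2 := Real.sq_sqrt (by positivity)
  rw [suppPlus, suppMinus, ← hr] at hle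
  set s := Real.sqrt (n 0 ^ 2 + n 1 ^ 2) with hs
  have hpos : 0 < r := by
    rcases hr0.eq_or_lt with h' | h'
    · exfalso
      rw [← h', zero_mul] at h2 h1
      have h0 : n 0 = 0 := by
        have : s = 0 := by linarith
        rw [this] at hs2
        nlinarith
      exact hn (ext_E3 h0 h1 h2)
    · exact h'
  have hsb : -n 1 ≤ s := by nlinarith [sq_nonneg (n 0)]
  refine ⟨?_, he.2, ?_⟩
  · have : r ^ 2 * ((e 1 - 1) ^ 2 + e 2 ^ 2 - 1) = 0 := by
      have e1 : n 1 ^ 2 = (r * (e 1 - 1)) ^ 2 := by rw [← h1]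
      have e2 : n 2 ^ 2 = (r * e 2) ^ 2 := by rw [← h2]
      linarith
    rcases mul_eq_zero.1 this with h' | h'
    · exact absurd h' (by positivity)
    · linarith
  · by_contra! hlt
    have : r * (e 1 - 1) < r * (-1 / 3) := mul_lt_mul_of_pos_left (by linarith) hpos
    linarith

/-- If a supporting plane of `body` meets the open segment from `d` to `e`, then it supports both
disks, at `d` and `e`. -/
lemma support_of_mem_openSegment {n d e : E3} {r : ℝ} (hr : r ∈ Ioo (0 : ℝ) 1)
    (hd : d ∈ diskMinus) (he : e ∈ diskPlus)
    (h : inner ℝ n (r • d + (1 - r) • e) = supp n) :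
    inner ℝ n d = suppMinus n ∧ inner ℝ n e = suppPlus n ∧ suppMinus n = suppPlus n := by
  rw [inner_add_right, real_inner_smul_right, real_inner_smul_right] at h
  have h1 := inner_le_suppMinus n hd
  have h2 := inner_le_suppPlus n he
  have h3 : suppMinus n ≤ supp n := le_max_left _ _
  have h4 : suppPlus n ≤ supp n := le_max_right _ _
  have h5 : inner ℝ n d = supp n := by
    by_contra hne
    have hlt := lt_of_le_of_ne (h1.trans h3) hne
    nlinarith [mul_lt_mul_of_pos_left hlt hr.1,
      mul_le_mul_of_nonneg_left (h2.trans h4) (sub_nonneg.2 hr.2.le)]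
  have h6 : inner ℝ n e = supp n := by
    by_contra hne
    have hlt := lt_of_le_of_ne (h2.trans h4) hne
    nlinarith [mul_lt_mul_of_pos_left hlt (sub_pos.2 hr.2),
      mul_le_mul_of_nonneg_left (h1.trans h3) hr.1.le]
  refine ⟨?_, ?_, ?_⟩ <;> linarith

/-- A boundary point lies on one of the two arcs, or strictly between the disks. -/
lemma frontier_cases {p : E3} (hp : p ∈ frontier body) :
    p ∈ arcMinus ∨ p ∈ arcPlus ∨
      ∃ d ∈ diskMinus, ∃ e ∈ diskPlus, ∃ r ∈ Ioo (0 : ℝ) 1, p = r • d + (1 - r) • e := by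
  obtain ⟨n, hn⟩ := exists_isExteriorUnitNormal hp
  have hpb : p ∈ body := isClosed_body.frontier_subset hp
  obtain ⟨h1, hs⟩ := (isExteriorUnitNormal_iff hpb).1 hn
  have hn0 : n ≠ 0 := by
    rintro rfl
    simp at h1
  obtain ⟨d, hd, e, he, r, hr, rfl⟩ := mem_body_iff.1 hpb
  rcases hr.1.eq_or_lt with h0 | h0
  · subst h0
    simp only [zero_smul, sub_zero, one_smul, zero_add] at hs ⊢
    have h2 := inner_le_suppPlus n he
    have h3 : suppPlus n ≤ supp n := le_max_right _ _
    have h4 : suppMinus n ≤ supp n := le_max_left _ _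
    exact Or.inr (Or.inl (mem_arcPlus hn0 he (by linarith) (by linarith)))
  rcases hr.2.eq_or_lt with h1 | h1
  · subst h1
    simp only [sub_self, one_smul, zero_smul, add_zero] at hs ⊢
    have h2 := inner_le_suppMinus n hd
    have h3 : suppPlus n ≤ supp n := le_max_right _ _
    have h4 : suppMinus n ≤ supp n := le_max_left _ _
    exact Or.inl (mem_arcMinus hn0 hd (by linarith) (by linarith))
  · exact Or.inr (Or.inr ⟨d, hd, e, he, r, ⟨h0, h1⟩, rfl⟩)

/-- The coordinates of a common support direction of both disks, in terms of the points of
contact. -/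
lemma coords_of_common_support {n d e : E3} (hd : d ∈ diskMinus) (he : e ∈ diskPlus)
    (h1 : inner ℝ n d = suppMinus n) (h2 : inner ℝ n e = suppPlus n)
    (h3 : suppMinus n = suppPlus n) :
    n = Real.sqrt (n 0 ^ 2 + n 1 ^ 2) • mk3 (d 0) (d 1 + 1) (-(1 + 2 * d 1) * e 2) ∧
      Real.sqrt (n 1 ^ 2 + n 2 ^ 2) = Real.sqrt (n 0 ^ 2 + n 1 ^ 2) * -(1 + 2 * d 1) := by
  obtain ⟨h4, h5⟩ := coords_of_inner_eq_suppMinus hd h1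
  obtain ⟨h6, h7⟩ := coords_of_inner_eq_suppPlus he h2
  rw [suppMinus, suppPlus] at h3
  have h8 : Real.sqrt (n 1 ^ 2 + n 2 ^ 2) = Real.sqrt (n 0 ^ 2 + n 1 ^ 2) * -(1 + 2 * d 1) := by
    linarith
  refine ⟨ext_E3 h4 h5 ?_, h8⟩
  rw [h8] at h7
  simp only [PiLp.smul_apply, smul_eq_mul, mk3_two]
  rw [h7]
  simp only [mul_assoc]

/-- The two contact points of a supporting plane with the disks determine its normal up to a
positive factor. -/
lemma normal_unique {n n' d e : E3} {r : ℝ} (hr : r ∈ Ioo (0 : ℝ) 1) (hd : d ∈ diskMinus)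
    (he : e ∈ diskPlus) (hn : IsExteriorUnitNormal body (r • d + (1 - r) • e) n)
    (hn' : IsExteriorUnitNormal body (r • d + (1 - r) • e) n') : n = n' := by
  have hpb : r • d + (1 - r) • e ∈ body :=
    mem_body_iff.2 ⟨d, hd, e, he, r, ⟨hr.1.le, hr.2.le⟩, rfl⟩
  rw [isExteriorUnitNormal_iff hpb] at hn hn'
  obtain ⟨h1, h2, h3⟩ := support_of_mem_openSegment hr hd he hn.2
  obtain ⟨h1', h2', h3'⟩ := support_of_mem_openSegment hr hd he hn'.2
  have e1 := (coords_of_common_support hd he h1 h2 h3).1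
  have e2 := (coords_of_common_support hd he h1' h2' h3').1
  set m := mk3 (d 0) (d 1 + 1) (-(1 + 2 * d 1) * e 2)
  have hρ := Real.sqrt_nonneg (n 0 ^ 2 + n 1 ^ 2)
  have hρ' := Real.sqrt_nonneg (n' 0 ^ 2 + n' 1 ^ 2)
  set ρ := Real.sqrt (n 0 ^ 2 + n 1 ^ 2)
  set ρ' := Real.sqrt (n' 0 ^ 2 + n' 1 ^ 2)
  have k1 : ρ * ‖m‖ = 1 := by
    rw [← hn.1, e1, norm_smul, Real.norm_of_nonneg hρ]
  have k2 : ρ' * ‖m‖ = 1 := by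
    rw [← hn'.1, e2, norm_smul, Real.norm_of_nonneg hρ']
  have hm : ‖m‖ ≠ 0 := by
    intro h
    rw [h, mul_zero] at k1
    exact zero_ne_one k1
  rw [e1, e2, mul_right_cancel₀ hm (k1.trans k2.symm)]

/-! ### The parametrization -/

lemma sgn_mul_self (s : ℤˣ) : sgn s * sgn s = 1 := by
  rcases Int.units_eq_one_or s with rfl | rfl <;> simp [sgn]

lemma sgn_sq (s : ℤˣ) : sgn s ^ 2 = 1 := by rw [sq, sgn_mul_self]

lemma exists_sgn_mul_nonneg (x : ℝ) : ∃ s : ℤˣ, 0 ≤ sgn s * x := by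
  rcases le_total 0 x with h | h
  · exact ⟨1, by simpa [sgn] using h⟩
  · exact ⟨-1, by simpa [sgn] using h⟩

lemma eq_sgn_mul_sqrt {s : ℤˣ} {x y : ℝ} (hx : 0 ≤ sgn s * x) (h : x ^ 2 = y) :
    x = sgn s * Real.sqrt y := by
  have : Real.sqrt y = sgn s * x := by
    rw [← h, ← Real.sqrt_sq hx, mul_pow, sgn_sq, one_mul]
  rw [this, ← mul_assoc, sgn_mul_self, one_mul]

/-- The `x`-coordinate of the contact point on the circle bounding `diskMinus`. -/
noncomputable def ca (v : ℝ) : ℝ := Real.sqrt (-v * (2 + v))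

/-- The `z`-coordinate of the common normal `(ca v, 1 + v, cc v)` of both disks. -/
noncomputable def cc (v : ℝ) : ℝ := Real.sqrt (v * (2 + 3 * v))

lemma ca_nonneg (v : ℝ) : 0 ≤ ca v := Real.sqrt_nonneg _
lemma cc_nonneg (v : ℝ) : 0 ≤ cc v := Real.sqrt_nonneg _

lemma ca_sq {v : ℝ} (hv : v ∈ Icc (-2 : ℝ) (-2 / 3)) : ca v ^ 2 = -v * (2 + v) :=
  Real.sq_sqrt (by nlinarith [hv.1, hv.2])

lemma cc_sq {v : ℝ} (hv : v ∈ Icc (-2 : ℝ) (-2 / 3)) : cc v ^ 2 = v * (2 + 3 * v) :=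
  Real.sq_sqrt (by nlinarith [hv.1, hv.2])

lemma ca_pos {v : ℝ} (hv : v ∈ Ioo (-2 : ℝ) (-2 / 3)) : 0 < ca v :=
  Real.sqrt_pos.2 (by nlinarith [hv.1, hv.2])

lemma cc_pos {v : ℝ} (hv : v ∈ Ioo (-2 : ℝ) (-2 / 3)) : 0 < cc v :=
  Real.sqrt_pos.2 (by nlinarith [hv.1, hv.2])

/-- The common support direction of both disks at the ruling with parameter `v`. -/
noncomputable def ruleNormal (s t : ℤˣ) (v : ℝ) : E3 :=
  mk3 (sgn s * ca v) (1 + v) (sgn t * cc v)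

lemma patch_eq (s t : ℤˣ) (u v : ℝ) :
    patch s t u v = mk3 (sgn s * (u * ca v)) (v * (1 + 2 * u * v) / (1 + 2 * v))
      (sgn t * ((-1 + u) * cc v / (1 + 2 * v))) := rfl

lemma patch_one {s t : ℤˣ} {v : ℝ} (hv : v ∈ Icc (-2 : ℝ) (-2 / 3)) :
    patch s t 1 v = mk3 (sgn s * ca v) v 0 := by
  have h : 1 + v * 2 ≠ 0 := by have := hv.2; intro h; linarith
  rw [patch_eq]
  refine ext_E3 (by simp) ?_ (by simp)
  simp only [mk3_one]
  field_simp

lemma patch_zero (s t : ℤˣ) (v : ℝ) :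
    patch s t 0 v = mk3 0 (v / (1 + 2 * v)) (sgn t * (-cc v / (1 + 2 * v))) := by
  rw [patch_eq]
  refine ext_E3 (by simp) (by simp) (by simp)

/-- The parameter lines in direction `u` are line segments joining the two circles. -/
lemma patch_ruled (s t : ℤˣ) (u v : ℝ) :
    patch s t u v = u • patch s t 1 v + (1 - u) • patch s t 0 v := by
  simp only [patch_eq]
  refine ext_E3 ?_ ?_ ?_ <;> simp <;> ring

lemma patch_one_mem {s t : ℤˣ} {v : ℝ} (hv : v ∈ Icc (-2 : ℝ) (-2 / 3)) :
    patch s t 1 v ∈ diskMinus := by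
  rw [patch_one hv]
  refine ⟨?_, rfl⟩
  simp only [mk3_zero, mk3_one, mul_pow, sgn_sq, ca_sq hv]
  nlinarith

lemma patch_zero_mem {s t : ℤˣ} {v : ℝ} (hv : v ∈ Icc (-2 : ℝ) (-2 / 3)) :
    patch s t 0 v ∈ diskPlus := by
  have h : 1 + v * 2 ≠ 0 := by have := hv.2; intro h; linarith
  rw [patch_zero]
  refine ⟨le_of_eq ?_, rfl⟩
  simp only [mk3_two, mk3_one, mul_pow, sgn_sq, div_pow, neg_sq, cc_sq hv]
  field_simp
  ring

lemma patch_mem_body {s t : ℤˣ} {u v : ℝ} (hu : u ∈ Icc (0 : ℝ) 1)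
    (hv : v ∈ Icc (-2 : ℝ) (-2 / 3)) : patch s t u v ∈ body :=
  mem_body_iff.2 ⟨_, patch_one_mem hv, _, patch_zero_mem hv, u, hu, patch_ruled s t u v⟩

lemma suppMinus_ruleNormal {s t : ℤˣ} {v : ℝ} (hv : v ∈ Icc (-2 : ℝ) (-2 / 3)) :
    suppMinus (ruleNormal s t v) = -v := by
  have h : (sgn s * ca v) ^ 2 + (1 + v) ^ 2 = 1 := by
    rw [mul_pow, sgn_sq, ca_sq hv]; ring
  rw [suppMinus, ruleNormal, mk3_zero, mk3_one, h, Real.sqrt_one]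
  ring

lemma suppPlus_ruleNormal {s t : ℤˣ} {v : ℝ} (hv : v ∈ Icc (-2 : ℝ) (-2 / 3)) :
    suppPlus (ruleNormal s t v) = -v := by
  have h : (1 + v) ^ 2 + (sgn t * cc v) ^ 2 = (-(1 + 2 * v)) ^ 2 := by
    rw [mul_pow, sgn_sq, cc_sq hv]; ring
  rw [suppPlus, ruleNormal, mk3_two, mk3_one, h, Real.sqrt_sq (by linarith [hv.2])]
  ring

lemma supp_ruleNormal {s t : ℤˣ} {v : ℝ} (hv : v ∈ Icc (-2 : ℝ) (-2 / 3)) :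
    supp (ruleNormal s t v) = -v := by
  rw [supp, suppMinus_ruleNormal hv, suppPlus_ruleNormal hv, max_self]

lemma inner_ruleNormal_patch {s t : ℤˣ} {v : ℝ} (u : ℝ) (hv : v ∈ Icc (-2 : ℝ) (-2 / 3)) :
    inner ℝ (ruleNormal s t v) (patch s t u v) = -v := by
  have h : 1 + v * 2 ≠ 0 := by have := hv.2; intro h; linarith
  rw [inner_E3, ruleNormal, patch_eq]
  simp only [mk3_zero, mk3_one, mk3_two]
  have e1 : sgn s * ca v * (sgn s * (u * ca v)) = u * (-v * (2 + v)) := by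
    rw [← ca_sq hv]
    linear_combination u * ca v ^ 2 * sgn_sq s
  have e2 : sgn t * cc v * (sgn t * ((-1 + u) * cc v / (1 + 2 * v))) =
      (-1 + u) * (v * (2 + 3 * v)) / (1 + 2 * v) := by
    rw [← cc_sq hv]
    linear_combination (-1 + u) * cc v ^ 2 / (1 + 2 * v) * sgn_sq t
  rw [e1, e2]
  field_simp
  ring

lemma norm_sq_ruleNormal {s t : ℤˣ} {v : ℝ} (hv : v ∈ Icc (-2 : ℝ) (-2 / 3)) :
    ‖ruleNormal s t v‖ ^ 2 = 1 + 2 * v + 3 * v ^ 2 := by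
  rw [norm_sq_E3, ruleNormal]
  simp only [mk3_zero, mk3_one, mk3_two, mul_pow, sgn_sq, ca_sq hv, cc_sq hv]
  ring

lemma ruleNormal_ne_zero {s t : ℤˣ} {v : ℝ} (hv : v ∈ Icc (-2 : ℝ) (-2 / 3)) :
    ruleNormal s t v ≠ 0 := by
  intro h
  have := norm_sq_ruleNormal (s := s) (t := t) hv
  rw [h, norm_zero] at this
  nlinarith [sq_nonneg (1 + 3 * v)]

lemma isExteriorUnitNormal_ruleNormal {s t : ℤˣ} {u v : ℝ}
    (hv : v ∈ Icc (-2 : ℝ) (-2 / 3)) :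
    IsExteriorUnitNormal body (patch s t u v) (‖ruleNormal s t v‖⁻¹ • ruleNormal s t v) := by
  have h0 := norm_pos_iff.2 (ruleNormal_ne_zero (s := s) (t := t) hv)
  refine ⟨?_, fun q hq => ?_⟩
  · rw [norm_smul, norm_inv, norm_norm, inv_mul_cancel₀ h0.ne']
  · rw [real_inner_smul_left, inner_sub_right, inner_ruleNormal_patch u hv]
    have := inner_le_supp (ruleNormal s t v) hq
    rw [supp_ruleNormal hv] at this
    exact mul_nonpos_of_nonneg_of_nonpos (by positivity) (by linarith)

lemma patch_one_eq_of_mem_arcMinus {s : ℤˣ} (t : ℤˣ) {p : E3} (hp : p ∈ arcMinus)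
    (hs : 0 ≤ sgn s * p 0) : p 1 ∈ Icc (-2 : ℝ) (-2 / 3) ∧ patch s t 1 (p 1) = p := by
  obtain ⟨h1, h2, h3⟩ := hp
  have hv : p 1 ∈ Icc (-2 : ℝ) (-2 / 3) := ⟨by nlinarith [sq_nonneg (p 0)], h3⟩
  refine ⟨hv, ?_⟩
  rw [patch_one hv]
  refine ext_E3 ?_ rfl h2.symm
  exact (eq_sgn_mul_sqrt hs (by linarith)).symm

lemma patch_zero_eq_of_mem_arcPlus (s : ℤˣ) {t : ℤˣ} {p : E3} {v : ℝ}
    (hv : v ∈ Icc (-2 : ℝ) (-2 / 3)) (hp : p ∈ diskPlus) (hp' : (p 1 - 1) ^ 2 + p 2 ^ 2 = 1)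
    (ht : 0 ≤ sgn t * p 2) (hpv : p 1 = v / (1 + 2 * v)) : patch s t 0 v = p := by
  have hw : 0 < -(1 + 2 * v) := by linarith [hv.2]
  have h : 1 + v * 2 ≠ 0 := by intro h; linarith
  rw [patch_zero]
  refine ext_E3 hp.2.symm hpv.symm ?_
  have h2 : -cc v / (1 + 2 * v) = Real.sqrt (p 2 ^ 2) := by
    symm
    rw [Real.sqrt_eq_iff_mul_self_eq (by positivity)]
    · have : p 2 ^ 2 = 1 - (v / (1 + 2 * v) - 1) ^ 2 := by rw [← hpv]; linarith
      rw [this, ← sq, div_pow, neg_sq, cc_sq hv]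
      field_simp
      ring
    · rw [neg_div, ← div_neg]
      exact div_nonneg (cc_nonneg v) hw.le
  rw [mk3_two, h2]
  exact (eq_sgn_mul_sqrt ht rfl).symm

/-- The map `v ↦ v / (1 + 2 v)` takes the `y`-coordinate of the end point of a ruling on the first
circle to that of the end point on the second; `y ↦ y / (1 - 2 y)` is its inverse. -/
lemma mem_arcPlus_param {p : E3} (hp : p ∈ arcPlus) :
    p 1 / (1 - 2 * p 1) ∈ Icc (-2 : ℝ) (-2 / 3) ∧
      p 1 = p 1 / (1 - 2 * p 1) / (1 + 2 * (p 1 / (1 - 2 * p 1))) := by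
  obtain ⟨h1, h2, h3⟩ := hp
  have h4 : p 1 ≤ 2 := by nlinarith [sq_nonneg (p 2)]
  have hneg : 1 - 2 * p 1 < 0 := by linarith
  refine ⟨⟨?_, ?_⟩, ?_⟩
  · rw [le_div_iff_of_neg hneg]; linarith
  · rw [div_le_iff_of_neg hneg]; linarith
  · have : 1 + 2 * (p 1 / (1 - 2 * p 1)) = 1 / (1 - 2 * p 1) := by
      rw [eq_div_iff hneg.ne, add_mul, mul_assoc, div_mul_cancel₀ _ hneg.ne]
      ring
    rw [this, div_div_eq_mul_div, div_one, div_mul_cancel₀ _ hneg.ne]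

/-- The patch with signs `s, t` covers the part of the boundary in `s x ≥ 0, t z ≥ 0`. -/
lemma patch_image (s t : ℤˣ) :
    (fun q : ℝ × ℝ => patch s t q.1 q.2) '' closedRect =
      frontier body ∩ {p | 0 ≤ sgn s * p 0 ∧ 0 ≤ sgn t * p 2} := by
  apply Subset.antisymm
  · rintro _ ⟨⟨u, v⟩, ⟨hu, hv⟩, rfl⟩
    refine ⟨mem_frontier_of_isExteriorUnitNormal (patch_mem_body hu hv)
      (isExteriorUnitNormal_ruleNormal hv), ?_, ?_⟩
    · simp only [patch_eq, mk3_zero, ← mul_assoc, sgn_mul_self, one_mul]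
      exact mul_nonneg hu.1 (ca_nonneg v)
    · simp only [patch_eq, mk3_two]
      rw [← mul_assoc, sgn_mul_self, one_mul]
      exact div_nonneg_of_nonpos (mul_nonpos_of_nonpos_of_nonneg (by linarith [hu.2])
        (cc_nonneg v)) (by linarith [hv.2])
  · rintro p ⟨hp, hs, ht⟩
    rcases frontier_cases hp with h | h | ⟨d, hd, e, he, r, hr, rfl⟩
    · obtain ⟨hv, h'⟩ := patch_one_eq_of_mem_arcMinus t h hs
      exact ⟨(1, p 1), ⟨⟨zero_le_one, le_rfl⟩, hv⟩, h'⟩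
    · obtain ⟨hv, h'⟩ := mem_arcPlus_param h
      exact ⟨(0, p 1 / (1 - 2 * p 1)), ⟨⟨le_rfl, zero_le_one⟩, hv⟩,
        patch_zero_eq_of_mem_arcPlus s hv ⟨h.1.le, h.2.1⟩ h.1 ht h'⟩
    · obtain ⟨n, hn⟩ := exists_isExteriorUnitNormal hp
      obtain ⟨hn1, hns⟩ := (isExteriorUnitNormal_iff (isClosed_body.frontier_subset hp)).1 hn
      have hn0 : n ≠ 0 := by
        rintro rfl
        simp at hn1
      obtain ⟨h1, h2, h3⟩ := support_of_mem_openSegment hr hd he hns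
      have had := mem_arcMinus hn0 hd h1 h3.ge
      have hae := mem_arcPlus hn0 he h2 h3.le
      have hs' : 0 ≤ sgn s * d 0 := by
        simp only [PiLp.add_apply, PiLp.smul_apply, smul_eq_mul, he.2] at hs
        have : 0 ≤ r * (sgn s * d 0) := by linarith
        exact nonneg_of_mul_nonneg_right this hr.1
      have ht' : 0 ≤ sgn t * e 2 := by
        simp only [PiLp.add_apply, PiLp.smul_apply, smul_eq_mul, hd.2] at ht
        have : 0 ≤ (1 - r) * (sgn t * e 2) := by linarith
        exact nonneg_of_mul_nonneg_right this (sub_pos.2 hr.2)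
      obtain ⟨hv, hpd⟩ := patch_one_eq_of_mem_arcMinus t had hs'
      obtain ⟨k1, k2⟩ := coords_of_common_support hd he h1 h2 h3
      have hρ : Real.sqrt (n 0 ^ 2 + n 1 ^ 2) ≠ 0 := by
        intro h
        rw [h, zero_smul] at k1
        exact hn0 k1
      have hne : 1 + d 1 * 2 ≠ 0 := by have := hv.2; intro h; linarith
      have hev : e 1 = d 1 / (1 + 2 * d 1) := by
        have e1 := (coords_of_inner_eq_suppMinus hd h1).2
        have e2 := (coords_of_inner_eq_suppPlus he h2).1
        rw [k2, mul_assoc] at e2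
        have e3 := e1.symm.trans e2
        have e4 := mul_left_cancel₀ hρ e3
        rw [eq_div_iff (by rwa [mul_comm 2])]
        linarith
      refine ⟨(r, d 1), ⟨⟨hr.1.le, hr.2.le⟩, hv⟩, ?_⟩
      simp only
      rw [patch_ruled, hpd, patch_zero_eq_of_mem_arcPlus s hv he hae.1 ht' hev]

/-- The supporting plane with normal `ruleNormal s t v'` touches `diskMinus` in a single point, with
`y`-coordinate `v'`, so that a point of the patch determines the ruling it lies on. -/
lemma patch_injOn (s t : ℤˣ) : InjOn (fun q : ℝ × ℝ => patch s t q.1 q.2) openRect := by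
  rintro ⟨u, v⟩ ⟨hu, hv⟩ ⟨u', v'⟩ ⟨hu', hv'⟩ h
  simp only at h hu hv hu' hv'
  have hvc := Ioo_subset_Icc_self hv
  have hvc' := Ioo_subset_Icc_self hv'
  have h1 : inner ℝ (ruleNormal s t v') (u • patch s t 1 v + (1 - u) • patch s t 0 v) =
      supp (ruleNormal s t v') := by
    rw [← patch_ruled, h, inner_ruleNormal_patch u' hvc', supp_ruleNormal hvc']
  have h2 := (support_of_mem_openSegment hu (patch_one_mem hvc) (patch_zero_mem hvc) h1).1
  have h3 := (coords_of_inner_eq_suppMinus (patch_one_mem hvc) h2).2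
  have h4 : Real.sqrt (ruleNormal s t v' 0 ^ 2 + ruleNormal s t v' 1 ^ 2) = 1 := by
    have := suppMinus_ruleNormal (s := s) (t := t) hvc'
    rw [suppMinus] at this
    have h5 : ruleNormal s t v' 1 = 1 + v' := rfl
    linarith
  rw [h4, patch_one hvc] at h3
  have h5 : ruleNormal s t v' 1 = 1 + v' := rfl
  rw [h5, mk3_one] at h3
  obtain rfl : v' = v := by linarith
  have h6 := congrArg (fun p : E3 => sgn s * p 0) h
  simp only [patch_eq, mk3_zero, ← mul_assoc, sgn_mul_self, one_mul] at h6
  rw [mul_right_cancel₀ (ca_pos hv).ne' h6]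

lemma edgeMinus_eq (s : ℤˣ) : edgeMinus s =
    {p | p 0 ^ 2 + (p 1 + 1) ^ 2 = 1 ∧ p 2 = 0 ∧ 0 ≤ sgn s * p 0 ∧ p 1 ≤ -2 / 3} := by
  apply Subset.antisymm
  · rintro _ ⟨v, hv, rfl⟩
    simp only [patch_one hv]
    refine ⟨?_, rfl, ?_, hv.2⟩
    · simp only [mk3_zero, mk3_one, mul_pow, sgn_sq, ca_sq hv]
      ring
    · simp only [mk3_zero, ← mul_assoc, sgn_mul_self, one_mul]
      exact ca_nonneg v
  · rintro p ⟨h1, h2, h3, h4⟩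
    obtain ⟨hv, h⟩ := patch_one_eq_of_mem_arcMinus 1 ⟨h1, h2, h4⟩ h3
    exact ⟨p 1, hv, h⟩

lemma edgePlus_eq (t : ℤˣ) : edgePlus t =
    {p | (p 1 - 1) ^ 2 + p 2 ^ 2 = 1 ∧ p 0 = 0 ∧ 0 ≤ sgn t * p 2 ∧ 2 / 3 ≤ p 1} := by
  apply Subset.antisymm
  · rintro _ ⟨v, hv, rfl⟩
    have hw : 1 + 2 * v < 0 := by linarith [hv.2]
    have hne : 1 + v * 2 ≠ 0 := by intro h; linarith
    simp only [patch_zero]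
    refine ⟨?_, rfl, ?_, ?_⟩
    · simp only [mk3_two, mk3_one, mul_pow, sgn_sq, div_pow, neg_sq, cc_sq hv]
      field_simp
      ring
    · rw [mk3_two, ← mul_assoc, sgn_mul_self, one_mul]
      exact div_nonneg_of_nonpos (neg_nonpos.2 (cc_nonneg v)) hw.le
    · rw [mk3_one, le_div_iff_of_neg hw]
      linarith [hv.1]
  · rintro p ⟨h1, h2, h3, h4⟩
    obtain ⟨hv, h⟩ := mem_arcPlus_param ⟨h1, h2, h4⟩
    exact ⟨_, hv, patch_zero_eq_of_mem_arcPlus 1 hv ⟨h1.le, h2⟩ h1 h3 h⟩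

lemma existsUnique_normal {p : E3} (hp : p ∈ frontier body) (h1 : ∀ s, p ∉ edgeMinus s)
    (h2 : ∀ t, p ∉ edgePlus t) : ∃! n, IsExteriorUnitNormal body p n := by
  obtain ⟨n, hn⟩ := exists_isExteriorUnitNormal hp
  refine ⟨n, hn, fun n' hn' => ?_⟩
  rcases frontier_cases hp with h | h | ⟨d, hd, e, he, r, hr, rfl⟩
  · obtain ⟨s, hs⟩ := exists_sgn_mul_nonneg (p 0)
    exact absurd (by rw [edgeMinus_eq]; exact ⟨h.1, h.2.1, hs, h.2.2⟩) (h1 s)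
  · obtain ⟨t, ht⟩ := exists_sgn_mul_nonneg (p 2)
    exact absurd (by rw [edgePlus_eq]; exact ⟨h.1, h.2.1, ht, h.2.2⟩) (h2 t)
  · exact normal_unique hr hd he hn' hn

/-! ### Partial derivatives and normals of the patches -/

lemma hasDerivAt_mk3 {f g h : ℝ → ℝ} {f' g' h' x : ℝ} (hf : HasDerivAt f f' x)
    (hg : HasDerivAt g g' x) (hh : HasDerivAt h h' x) :
    HasDerivAt (fun r => mk3 (f r) (g r) (h r)) (mk3 f' g' h') x := by
  have hpi : HasDerivAt (fun r => ![f r, g r, h r]) ![f', g', h'] x := by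
    rw [hasDerivAt_pi]
    intro i
    fin_cases i <;> assumption
  exact ((PiLp.continuousLinearEquiv 2 ℝ
    (fun _ : Fin 3 => ℝ)).symm.toContinuousLinearMap.hasFDerivAt.comp_hasDerivAt x hpi)

lemma cross_zero (a b : E3) : cross a b 0 = a 1 * b 2 - a 2 * b 1 := by
  simp [cross, cross_apply]

lemma cross_one (a b : E3) : cross a b 1 = a 2 * b 0 - a 0 * b 2 := by
  simp [cross, cross_apply]

lemma cross_two (a b : E3) : cross a b 2 = a 0 * b 1 - a 1 * b 0 := by
  simp [cross, cross_apply]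

/-- Lagrange's identity. -/
lemma lagrange_identity (a b : E3) :
    inner ℝ a a * inner ℝ b b - inner ℝ a b ^ 2 = ‖cross a b‖ ^ 2 := by
  rw [norm_sq_E3, cross_zero, cross_one, cross_two]
  simp only [inner_E3]
  ring

lemma hasDerivAt_ca {v : ℝ} (hv : v ∈ Ioo (-2 : ℝ) (-2 / 3)) :
    HasDerivAt ca (-(1 + v) / ca v) v := by
  have h : HasDerivAt (fun v : ℝ => -v * (2 + v)) (-1 * (2 + v) + -v * 1) v :=
    (hasDerivAt_id v).neg.mul ((hasDerivAt_id v).const_add 2)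
  have h2 := h.sqrt (by have := hv.1; have := hv.2; nlinarith)
  convert! h2 using 1
  have := (ca_pos hv).ne'
  change _ = _ / (2 * ca v)
  field_simp
  ring

lemma hasDerivAt_cc {v : ℝ} (hv : v ∈ Ioo (-2 : ℝ) (-2 / 3)) :
    HasDerivAt cc ((1 + 3 * v) / cc v) v := by
  have h : HasDerivAt (fun v : ℝ => v * (2 + 3 * v)) (1 * (2 + 3 * v) + v * (3 * 1)) v :=
    (hasDerivAt_id v).mul (((hasDerivAt_id v).const_mul 3).const_add 2)
  have h2 := h.sqrt (by have := hv.1; have := hv.2; nlinarith)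
  convert! h2 using 1
  have := (cc_pos hv).ne'
  change _ = _ / (2 * cc v)
  field_simp
  ring

lemma partialU_patch (s t : ℤˣ) (u v : ℝ) :
    partialU (patch s t) u v =
      mk3 (sgn s * ca v) (2 * v ^ 2 / (1 + 2 * v)) (sgn t * (cc v / (1 + 2 * v))) := by
  refine HasDerivAt.deriv ?_
  have h0 : HasDerivAt (fun r => sgn s * (r * ca v)) (sgn s * (1 * ca v)) u :=
    ((hasDerivAt_id u).mul_const _).const_mul _
  have h1 : HasDerivAt (fun r => v * (1 + 2 * r * v) / (1 + 2 * v))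
      (v * (2 * 1 * v) / (1 + 2 * v)) u :=
    ((((((hasDerivAt_id u).const_mul 2).mul_const v).const_add 1).const_mul v).div_const _)
  have h2 : HasDerivAt (fun r => sgn t * ((-1 + r) * cc v / (1 + 2 * v)))
      (sgn t * (1 * cc v / (1 + 2 * v))) u :=
    (((((hasDerivAt_id u).const_add (-1)).mul_const _).div_const _).const_mul _)
  convert! hasDerivAt_mk3 h0 h1 h2 using 2 <;> ring

lemma partialV_patch (s t : ℤˣ) (u : ℝ) {v : ℝ} (hv : v ∈ Ioo (-2 : ℝ) (-2 / 3)) :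
    partialV (patch s t) u v =
      mk3 (sgn s * (u * (-(1 + v) / ca v))) ((1 + 4 * u * v + 4 * u * v ^ 2) / (1 + 2 * v) ^ 2)
        (sgn t * ((-1 + u) * (1 + v) / (cc v * (1 + 2 * v) ^ 2))) := by
  have hw : 1 + v * 2 ≠ 0 := by have := hv.2; intro h; linarith
  have hw' : 1 + 2 * v ≠ 0 := by rwa [mul_comm 2]
  have hc := (cc_pos hv).ne'
  refine HasDerivAt.deriv ?_
  have hd : HasDerivAt (fun r : ℝ => 1 + 2 * r) (2 * 1) v :=
    ((hasDerivAt_id v).const_mul 2).const_add 1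
  have h0 : HasDerivAt (fun r => sgn s * (u * ca r)) (sgn s * (u * (-(1 + v) / ca v))) v :=
    ((hasDerivAt_ca hv).const_mul _).const_mul _
  have h1 : HasDerivAt (fun r => r * (1 + 2 * u * r) / (1 + 2 * r))
      (((1 * (1 + 2 * u * v) + v * (2 * u * 1)) * (1 + 2 * v) - v * (1 + 2 * u * v) * (2 * 1)) /
        (1 + 2 * v) ^ 2) v :=
    ((hasDerivAt_id v).mul (((hasDerivAt_id v).const_mul (2 * u)).const_add 1)).div hd hw'
  have h2 : HasDerivAt (fun r => sgn t * ((-1 + u) * cc r / (1 + 2 * r)))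
      (sgn t * (((-1 + u) * ((1 + 3 * v) / cc v) * (1 + 2 * v) - (-1 + u) * cc v * (2 * 1)) /
        (1 + 2 * v) ^ 2)) v :=
    (((hasDerivAt_cc hv).const_mul _).div hd hw').const_mul _
  convert! hasDerivAt_mk3 h0 h1 h2 using 2
  · ring
  · congr 1
    rw [div_eq_div_iff (by positivity) (by positivity)]
    have h3 : cc v * ((1 + 3 * v) / cc v) = 1 + 3 * v := mul_div_cancel₀ _ hc
    have h4 := cc_sq (Ioo_subset_Icc_self hv)
    linear_combination
      -((-1 + u) * (1 + 2 * v) ^ 3) * h3 + 2 * (-1 + u) * (1 + 2 * v) ^ 2 * h4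

/-- The factor by which `X_u × X_v` is a multiple of `ruleNormal`, up to sign. -/
noncomputable def crossFactor (u v : ℝ) : ℝ :=
  ca v * cc v * (u / (v * (2 + v) * (1 + 2 * v)) + (1 - u) / (v * (2 + 3 * v) * (1 + 2 * v) ^ 2))

lemma crossFactor_pos {u v : ℝ} (hu : u ∈ Icc (0 : ℝ) 1) (hv : v ∈ Ioo (-2 : ℝ) (-2 / 3)) :
    0 < crossFactor u v := by
  have ha := ca_pos hv
  have hc := cc_pos hv
  obtain ⟨hv1, hv2⟩ := hv
  have h1 : 0 < v * (2 + v) * (1 + 2 * v) :=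
    mul_pos_of_neg_of_neg (by nlinarith) (by linarith)
  have h2 : 0 < v * (2 + 3 * v) * (1 + 2 * v) ^ 2 :=
    mul_pos (by nlinarith) (by nlinarith)
  refine mul_pos (mul_pos ha hc) ?_
  rcases hu.1.eq_or_lt with h | h
  · rw [← h, zero_div, zero_add, sub_zero]
    exact one_div_pos.2 h2
  · exact add_pos_of_pos_of_nonneg (div_pos h h1) (div_nonneg (by linarith [hu.2]) h2.le)

lemma div_ca {v : ℝ} (hv : v ∈ Ioo (-2 : ℝ) (-2 / 3)) (x : ℝ) :
    x / ca v = x * ca v / (-v * (2 + v)) := by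
  rw [← ca_sq (Ioo_subset_Icc_self hv)]
  have := (ca_pos hv).ne'
  field_simp

lemma div_cc {v : ℝ} (hv : v ∈ Ioo (-2 : ℝ) (-2 / 3)) (x : ℝ) :
    x / cc v = x * cc v / (v * (2 + 3 * v)) := by
  rw [← cc_sq (Ioo_subset_Icc_self hv)]
  have := (cc_pos hv).ne'
  field_simp

lemma nonvanishing {v : ℝ} (hv : v ∈ Ioo (-2 : ℝ) (-2 / 3)) :
    v ≠ 0 ∧ 2 + v ≠ 0 ∧ 2 + v * 3 ≠ 0 ∧ 1 + v * 2 ≠ 0 ∧ 1 + 2 * v ≠ 0 := by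
  obtain ⟨h1, h2⟩ := hv
  refine ⟨?_, ?_, ?_, ?_, ?_⟩ <;> intro h <;> linarith

lemma cross_partials (s t : ℤˣ) (u : ℝ) {v : ℝ} (hv : v ∈ Ioo (-2 : ℝ) (-2 / 3)) :
    cross (partialU (patch s t) u v) (partialV (patch s t) u v) =
      (sgn s * sgn t * crossFactor u v) • ruleNormal s t v := by
  have ha := ca_sq (Ioo_subset_Icc_self hv)
  have hc := cc_sq (Ioo_subset_Icc_self hv)
  have hs := sgn_sq s
  have ht := sgn_sq t
  obtain ⟨n1, n2, n3, n4, n5⟩ := nonvanishing hv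
  rw [partialU_patch, partialV_patch s t u hv, ruleNormal, crossFactor]
  refine ext_E3 ?_ ?_ ?_
  · rw [cross_zero]
    simp only [mk3_zero, mk3_one, mk3_two, PiLp.smul_apply, smul_eq_mul]
    rw [← div_div, div_cc hv]
    have e : ∀ R : ℝ, sgn s * sgn t * (ca v * cc v * R) * (sgn s * ca v) =
        sgn t * (-v * (2 + v)) * cc v * R := fun R => by
      rw [← ha]
      linear_combination ca v ^ 2 * cc v * R * sgn t * hs
    rw [e]
    field_simp
    ring
  · rw [cross_one]
    simp only [mk3_zero, mk3_one, mk3_two, PiLp.smul_apply, smul_eq_mul]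
    rw [← div_div, div_cc hv, div_ca hv]
    field_simp
    ring
  · rw [cross_two]
    simp only [mk3_zero, mk3_one, mk3_two, PiLp.smul_apply, smul_eq_mul]
    rw [div_ca hv]
    have e : ∀ R : ℝ, sgn s * sgn t * (ca v * cc v * R) * (sgn t * cc v) =
        sgn s * (v * (2 + 3 * v)) * ca v * R := fun R => by
      rw [← hc]
      linear_combination cc v ^ 2 * ca v * R * sgn s * ht
    rw [e]
    field_simp
    ring

lemma abs_sgn (s : ℤˣ) : |sgn s| = 1 := by
  rcases Int.units_eq_one_or s with rfl | rfl <;> simp [sgn]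

lemma norm_cross_partials (s t : ℤˣ) {u v : ℝ} (hu : u ∈ Icc (0 : ℝ) 1)
    (hv : v ∈ Ioo (-2 : ℝ) (-2 / 3)) :
    ‖cross (partialU (patch s t) u v) (partialV (patch s t) u v)‖ =
      crossFactor u v * ‖ruleNormal s t v‖ := by
  rw [cross_partials s t u hv, norm_smul, Real.norm_eq_abs, abs_mul, abs_mul, abs_sgn, abs_sgn,
    one_mul, one_mul, abs_of_pos (crossFactor_pos hu hv)]

/-- The oriented unit normal of a patch is constant along the rulings. -/
lemma patchNormal_eq (s t : ℤˣ) {u v : ℝ} (hu : u ∈ Icc (0 : ℝ) 1)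
    (hv : v ∈ Ioo (-2 : ℝ) (-2 / 3)) :
    patchNormal s t u v = ‖ruleNormal s t v‖⁻¹ • ruleNormal s t v := by
  have hk := (crossFactor_pos hu hv).ne'
  rw [patchNormal, unitNormal, norm_cross_partials s t hu hv, cross_partials s t u hv, smul_smul,
    smul_smul]
  congr 1
  rw [mul_inv]
  have h1 := sgn_sq s
  have h2 := sgn_sq t
  have h3 : (crossFactor u v)⁻¹ * crossFactor u v = 1 := inv_mul_cancel₀ hk
  linear_combination ‖ruleNormal s t v‖⁻¹ * (sgn s ^ 2 * sgn t ^ 2 * h3 + sgn t ^ 2 * h1 + h2)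

/-! ### Mean curvature of the patches -/

/-- The derivative of `ruleNormal`. -/
noncomputable def ruleNormalDeriv (s t : ℤˣ) (v : ℝ) : E3 :=
  mk3 (sgn s * (-(1 + v) / ca v)) 1 (sgn t * ((1 + 3 * v) / cc v))

lemma hasDerivAt_ruleNormal (s t : ℤˣ) {v : ℝ} (hv : v ∈ Ioo (-2 : ℝ) (-2 / 3)) :
    HasDerivAt (ruleNormal s t) (ruleNormalDeriv s t v) v :=
  hasDerivAt_mk3 ((hasDerivAt_ca hv).const_mul _) ((hasDerivAt_id v).const_add 1)
    ((hasDerivAt_cc hv).const_mul _)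

lemma partialU_patchNormal (s t : ℤˣ) {u v : ℝ} (hu : u ∈ Ioo (0 : ℝ) 1)
    (hv : v ∈ Ioo (-2 : ℝ) (-2 / 3)) : partialU (patchNormal s t) u v = 0 := by
  have h : (fun r => patchNormal s t r v) =ᶠ[nhds u]
      fun _ => ‖ruleNormal s t v‖⁻¹ • ruleNormal s t v := by
    filter_upwards [Ioo_mem_nhds hu.1 hu.2] with r hr
    exact patchNormal_eq s t (Ioo_subset_Icc_self hr) hv
  rw [partialU, h.deriv_eq, deriv_const]

/-- Modulo `ruleNormal`, which is orthogonal to both partial derivatives of the patch, the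
derivative of the unit normal is a multiple of `ruleNormalDeriv`. -/
lemma exists_partialV_patchNormal (s t : ℤˣ) {u v : ℝ} (hu : u ∈ Ioo (0 : ℝ) 1)
    (hv : v ∈ Ioo (-2 : ℝ) (-2 / 3)) : ∃ r : ℝ, partialV (patchNormal s t) u v =
      r • ruleNormal s t v + ‖ruleNormal s t v‖⁻¹ • ruleNormalDeriv s t v := by
  have h : (fun r => patchNormal s t u r) =ᶠ[nhds v]
      fun r => ‖ruleNormal s t r‖⁻¹ • ruleNormal s t r := by
    filter_upwards [Ioo_mem_nhds hv.1 hv.2] with r hr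
    exact patchNormal_eq s t (Ioo_subset_Icc_self hu) hr
  have hne := ruleNormal_ne_zero (s := s) (t := t) (Ioo_subset_Icc_self hv)
  have hN := hasDerivAt_ruleNormal s t hv
  have hnorm : DifferentiableAt ℝ (fun r => ‖ruleNormal s t r‖⁻¹) v :=
    (hN.differentiableAt.norm ℝ hne).inv (norm_ne_zero_iff.2 hne)
  refine ⟨deriv (fun r => ‖ruleNormal s t r‖⁻¹) v, ?_⟩
  have hd : HasDerivAt (fun r => ‖ruleNormal s t r‖⁻¹ • ruleNormal s t r) _ v :=
    hnorm.hasDerivAt.smul hN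
  rw [partialV, h.deriv_eq, hd.deriv, add_comm]

lemma inner_partialU_ruleNormal (s t : ℤˣ) (u : ℝ) {v : ℝ} (hv : v ∈ Ioo (-2 : ℝ) (-2 / 3)) :
    inner ℝ (partialU (patch s t) u v) (ruleNormal s t v) = 0 := by
  obtain ⟨n1, n2, n3, n4, n5⟩ := nonvanishing hv
  rw [partialU_patch, inner_E3, ruleNormal]
  simp only [mk3_zero, mk3_one, mk3_two]
  have e1 : sgn s * ca v * (sgn s * ca v) = -v * (2 + v) := by
    rw [← ca_sq (Ioo_subset_Icc_self hv)]
    linear_combination ca v ^ 2 * sgn_sq s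
  have e2 : sgn t * (cc v / (1 + 2 * v)) * (sgn t * cc v) = v * (2 + 3 * v) / (1 + 2 * v) := by
    rw [← cc_sq (Ioo_subset_Icc_self hv)]
    linear_combination cc v ^ 2 / (1 + 2 * v) * sgn_sq t
  rw [e1, e2]
  field_simp
  ring

/-- The rulings are orthogonal to the derivative of the normal, not only to the normal: the surface
is developable. -/
lemma inner_partialU_ruleNormalDeriv (s t : ℤˣ) (u : ℝ) {v : ℝ}
    (hv : v ∈ Ioo (-2 : ℝ) (-2 / 3)) :
    inner ℝ (partialU (patch s t) u v) (ruleNormalDeriv s t v) = 0 := by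
  obtain ⟨n1, n2, n3, n4, n5⟩ := nonvanishing hv
  have ha := (ca_pos hv).ne'
  have hc := (cc_pos hv).ne'
  rw [partialU_patch, inner_E3, ruleNormalDeriv]
  simp only [mk3_zero, mk3_one, mk3_two]
  have e1 : sgn s * ca v * (sgn s * (-(1 + v) / ca v)) = -(1 + v) := by
    have : ca v * (-(1 + v) / ca v) = -(1 + v) := mul_div_cancel₀ _ ha
    linear_combination sgn s ^ 2 * this - (1 + v) * sgn_sq s
  have e2 : sgn t * (cc v / (1 + 2 * v)) * (sgn t * ((1 + 3 * v) / cc v)) =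
      (1 + 3 * v) / (1 + 2 * v) := by
    have : cc v * ((1 + 3 * v) / cc v) = 1 + 3 * v := mul_div_cancel₀ _ hc
    linear_combination sgn t ^ 2 / (1 + 2 * v) * this + (1 + 3 * v) / (1 + 2 * v) * sgn_sq t
  rw [e1, e2]
  field_simp
  ring

lemma inner_partialV_ruleNormal (s t : ℤˣ) (u : ℝ) {v : ℝ} (hv : v ∈ Ioo (-2 : ℝ) (-2 / 3)) :
    inner ℝ (partialV (patch s t) u v) (ruleNormal s t v) = 0 := by
  obtain ⟨n1, n2, n3, n4, n5⟩ := nonvanishing hv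
  have ha := (ca_pos hv).ne'
  have hc := (cc_pos hv).ne'
  rw [partialV_patch s t u hv, inner_E3, ruleNormal]
  simp only [mk3_zero, mk3_one, mk3_two]
  have e1 : sgn s * (u * (-(1 + v) / ca v)) * (sgn s * ca v) = -(u * (1 + v)) := by
    have : ca v * (-(1 + v) / ca v) = -(1 + v) := mul_div_cancel₀ _ ha
    linear_combination sgn s ^ 2 * u * this - u * (1 + v) * sgn_sq s
  have e2 : sgn t * ((-1 + u) * (1 + v) / (cc v * (1 + 2 * v) ^ 2)) * (sgn t * cc v) =
      (-1 + u) * (1 + v) / (1 + 2 * v) ^ 2 := by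
    rw [← div_div]
    have : cc v * ((-1 + u) * (1 + v) / cc v) = (-1 + u) * (1 + v) := mul_div_cancel₀ _ hc
    linear_combination sgn t ^ 2 / (1 + 2 * v) ^ 2 * this +
      (-1 + u) * (1 + v) / (1 + 2 * v) ^ 2 * sgn_sq t
  rw [e1, e2]
  field_simp
  ring

/-- Up to normalization of the normal, the coefficient `N` of the second fundamental form. -/
lemma inner_partialV_ruleNormalDeriv (s t : ℤˣ) (u : ℝ) {v : ℝ}
    (hv : v ∈ Ioo (-2 : ℝ) (-2 / 3)) :
    inner ℝ (partialV (patch s t) u v) (ruleNormalDeriv s t v) =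
      crossFactor u v * (-(1 + 2 * v) / (ca v * cc v)) := by
  obtain ⟨n1, n2, n3, n4, n5⟩ := nonvanishing hv
  have ha := (ca_pos hv).ne'
  have hc := (cc_pos hv).ne'
  rw [partialV_patch s t u hv, inner_E3, ruleNormalDeriv, crossFactor]
  simp only [mk3_zero, mk3_one, mk3_two]
  have e1 : sgn s * (u * (-(1 + v) / ca v)) * (sgn s * (-(1 + v) / ca v)) =
      u * (1 + v) ^ 2 / (-v * (2 + v)) := by
    rw [← ca_sq (Ioo_subset_Icc_self hv)]
    linear_combination (u * (1 + v) ^ 2 / ca v ^ 2) * sgn_sq s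
  have e2 : sgn t * ((-1 + u) * (1 + v) / (cc v * (1 + 2 * v) ^ 2)) *
      (sgn t * ((1 + 3 * v) / cc v)) =
      (-1 + u) * (1 + v) * (1 + 3 * v) / (v * (2 + 3 * v) * (1 + 2 * v) ^ 2) := by
    rw [← cc_sq (Ioo_subset_Icc_self hv)]
    generalize 1 + 2 * v = w
    linear_combination
      ((-1 + u) * (1 + v) * (1 + 3 * v) / (cc v ^ 2 * w ^ 2)) * sgn_sq t
  have e3 : ∀ R S : ℝ, ca v * cc v * R * (S / (ca v * cc v)) = R * S := fun R S => by
    field_simp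
  rw [e1, e2, e3]
  field_simp
  ring

lemma ffE_patch (s t : ℤˣ) (u : ℝ) {v : ℝ} (hv : v ∈ Ioo (-2 : ℝ) (-2 / 3)) :
    ffE (patch s t) u v = 6 * v ^ 2 / -(1 + 2 * v) := by
  obtain ⟨n1, n2, n3, n4, n5⟩ := nonvanishing hv
  rw [ffE, partialU_patch, inner_E3]
  simp only [mk3_zero, mk3_one, mk3_two]
  have e1 : sgn s * ca v * (sgn s * ca v) = -v * (2 + v) := by
    rw [← ca_sq (Ioo_subset_Icc_self hv)]
    linear_combination ca v ^ 2 * sgn_sq s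
  have e2 : sgn t * (cc v / (1 + 2 * v)) * (sgn t * (cc v / (1 + 2 * v))) =
      v * (2 + 3 * v) / (1 + 2 * v) ^ 2 := by
    rw [← cc_sq (Ioo_subset_Icc_self hv)]
    generalize 1 + 2 * v = w
    linear_combination cc v ^ 2 / w ^ 2 * sgn_sq t
  rw [e1, e2]
  field_simp
  ring

/-- The rulings are lines of curvature with principal curvature zero, so that only the coefficient
`N` of the second fundamental form survives; the resulting density does not depend on `u`. -/
lemma curvatureDensity_eq (s t : ℤˣ) {q : ℝ × ℝ} (hq : q ∈ openRect) :
    curvatureDensity s t q =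
      3 * q.2 ^ 2 / (ca q.2 * cc q.2 * (1 + 2 * q.2 + 3 * q.2 ^ 2)) := by
  obtain ⟨u, v⟩ := q
  obtain ⟨hu, hv⟩ : u ∈ Ioo (0 : ℝ) 1 ∧ v ∈ Ioo (-2 : ℝ) (-2 / 3) := hq
  obtain ⟨n1, n2, n3, n4, n5⟩ := nonvanishing hv
  have ha := (ca_pos hv).ne'
  have hc := (cc_pos hv).ne'
  obtain ⟨r, hr⟩ := exists_partialV_patchNormal s t hu hv
  have hL : sfL (patch s t) (patchNormal s t) u v = 0 := by
    rw [sfL, partialU_patchNormal s t hu hv, inner_zero_right]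
  have hM : sfM (patch s t) (patchNormal s t) u v = 0 := by
    rw [sfM, partialU_patchNormal s t hu hv, inner_zero_right, hr, inner_add_right,
      real_inner_smul_right, real_inner_smul_right, inner_partialU_ruleNormal s t u hv,
      inner_partialU_ruleNormalDeriv s t u hv]
    ring
  have hN : sfN (patch s t) (patchNormal s t) u v =
      ‖ruleNormal s t v‖⁻¹ * (crossFactor u v * (-(1 + 2 * v) / (ca v * cc v))) := by
    rw [sfN, hr, inner_add_right, real_inner_smul_right, real_inner_smul_right,
      inner_partialV_ruleNormal s t u hv, inner_partialV_ruleNormalDeriv s t u hv]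
    ring
  have hk := crossFactor_pos (Ioo_subset_Icc_self hu) hv
  have hn := norm_pos_iff.2 (ruleNormal_ne_zero (s := s) (t := t) (Ioo_subset_Icc_self hv))
  have hEG : ffE (patch s t) u v * ffG (patch s t) u v - ffF (patch s t) u v ^ 2 =
      (crossFactor u v * ‖ruleNormal s t v‖) ^ 2 := by
    rw [ffE, ffF, ffG, lagrange_identity, norm_cross_partials s t (Ioo_subset_Icc_self hu) hv]
  rw [curvatureDensity, meanCurvature, areaDensity, hEG, hL, hM, hN, ffE_patch s t u hv,
    Real.sqrt_sq (by positivity)]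
  simp only
  rw [← norm_sq_ruleNormal (s := s) (t := t) (Ioo_subset_Icc_self hv)]
  field_simp
  ring

/-! ### Dihedral angle and arclength along the edges -/

lemma arccos_one_sub_sq_div {x : ℝ} (hx : 0 ≤ x) :
    Real.arccos ((1 - x ^ 2) / (1 + x ^ 2)) = 2 * Real.arctan x := by
  have h : (1 - x ^ 2) / (1 + x ^ 2) = Real.cos (2 * Real.arctan x) := by
    rw [Real.cos_two_mul, Real.cos_sq_arctan]
    have : 1 + x ^ 2 ≠ 0 := by positivity
    field_simp
    ring
  rw [h, Real.arccos_cos]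
  · have := Real.arctan_nonneg.2 hx
    linarith
  · linarith [Real.arctan_lt_pi_div_two x]

lemma angle_patchNormal (s t s' t' : ℤˣ) {u v : ℝ} (hu : u ∈ Icc (0 : ℝ) 1)
    (hv : v ∈ Ioo (-2 : ℝ) (-2 / 3)) :
    InnerProductGeometry.angle (patchNormal s t u v) (patchNormal s' t' u v) =
      Real.arccos (inner ℝ (ruleNormal s t v) (ruleNormal s' t' v) / (1 + 2 * v + 3 * v ^ 2)) := by
  have hvc := Ioo_subset_Icc_self hv
  have h1 := norm_pos_iff.2 (ruleNormal_ne_zero (s := s) (t := t) hvc)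
  have h2 := norm_pos_iff.2 (ruleNormal_ne_zero (s := s') (t := t') hvc)
  have h3 : ‖ruleNormal s t v‖ = ‖ruleNormal s' t' v‖ := by
    rw [← sq_eq_sq₀ h1.le h2.le, norm_sq_ruleNormal hvc, norm_sq_ruleNormal hvc]
  rw [patchNormal_eq s t hu hv, patchNormal_eq s' t' hu hv,
    InnerProductGeometry.angle_smul_left_of_pos _ _ (inv_pos.2 h1),
    InnerProductGeometry.angle_smul_right_of_pos _ _ (inv_pos.2 h2),
    InnerProductGeometry.angle, ← h3, ← sq, norm_sq_ruleNormal hvc]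

lemma edgeMinusDensity_eq (s : ℤˣ) {v : ℝ} (hv : v ∈ Ioo (-2 : ℝ) (-2 / 3)) :
    edgeMinusDensity s v = 2 * Real.arctan (cc v) / ca v := by
  have hvc := Ioo_subset_Icc_self hv
  obtain ⟨n1, n2, n3, n4, n5⟩ := nonvanishing hv
  have hangle : InnerProductGeometry.angle (patchNormal s 1 1 v) (patchNormal s (-1) 1 v) =
      2 * Real.arctan (cc v) := by
    rw [angle_patchNormal s 1 s (-1) ⟨zero_le_one, le_rfl⟩ hv,
      ← arccos_one_sub_sq_div (cc_nonneg v)]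
    congr 2
    · rw [inner_E3, ruleNormal, ruleNormal, cc_sq hvc]
      simp only [mk3_zero, mk3_one, mk3_two]
      have h1 : sgn (1 : ℤˣ) * cc v * (sgn (-1) * cc v) = -(v * (2 + 3 * v)) := by
        rw [← cc_sq hvc]
        simp [sgn]
        ring
      have h2 : sgn s * ca v * (sgn s * ca v) = -v * (2 + v) := by
        rw [← ca_sq hvc]
        linear_combination ca v ^ 2 * sgn_sq s
      rw [h1, h2]
      ring
    · rw [cc_sq hvc]
      ring
  have hnorm : ‖deriv (fun r => patch s 1 1 r) v‖ = 1 / ca v := by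
    change ‖partialV (patch s 1) 1 v‖ = _
    have ha := ca_pos hv
    rw [← sq_eq_sq₀ (norm_nonneg _) (by positivity), norm_sq_E3, partialV_patch s 1 1 hv]
    simp only [mk3_zero, mk3_one, mk3_two, mul_pow, div_pow, sgn_sq, ca_sq hvc]
    field_simp
    ring
  rw [edgeMinusDensity, hangle, hnorm]
  ring

lemma edgePlusDensity_eq (t : ℤˣ) {v : ℝ} (hv : v ∈ Ioo (-2 : ℝ) (-2 / 3)) :
    edgePlusDensity t v =
      2 * Real.arctan (ca v / -(1 + 2 * v)) / (cc v * -(1 + 2 * v)) := by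
  have hvc := Ioo_subset_Icc_self hv
  obtain ⟨n1, n2, n3, n4, n5⟩ := nonvanishing hv
  have hw : 0 < -(1 + 2 * v) := by linarith [hv.2]
  have hpos : 0 < 1 + 2 * v + 3 * v ^ 2 := by nlinarith [sq_nonneg (1 + 3 * v)]
  have hangle : InnerProductGeometry.angle (patchNormal 1 t 0 v) (patchNormal (-1) t 0 v) =
      2 * Real.arctan (ca v / -(1 + 2 * v)) := by
    rw [angle_patchNormal 1 t (-1) t ⟨le_rfl, zero_le_one⟩ hv,
      ← arccos_one_sub_sq_div (div_nonneg (ca_nonneg v) hw.le)]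
    congr 1
    have h1 : sgn (1 : ℤˣ) * ca v * (sgn (-1) * ca v) = -(-v * (2 + v)) := by
      rw [← ca_sq hvc]
      simp [sgn]
      ring
    have h2 : sgn t * cc v * (sgn t * cc v) = v * (2 + 3 * v) := by
      rw [← cc_sq hvc]
      linear_combination cc v ^ 2 * sgn_sq t
    rw [inner_E3, ruleNormal, ruleNormal]
    simp only [mk3_zero, mk3_one, mk3_two]
    rw [h1, h2, div_pow, ca_sq hvc, neg_sq]
    have hw2 : (1 + 2 * v) ^ 2 ≠ 0 := by nlinarith
    rw [one_sub_div hw2, one_add_div hw2, div_div_div_cancel_right₀ hw2]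
    congr 1 <;> ring
  have hnorm : ‖deriv (fun r => patch 1 t 0 r) v‖ = 1 / (cc v * -(1 + 2 * v)) := by
    change ‖partialV (patch 1 t) 0 v‖ = _
    have hc := cc_pos hv
    rw [← sq_eq_sq₀ (norm_nonneg _) (by positivity), norm_sq_E3, partialV_patch 1 t 0 hv]
    simp only [mk3_zero, mk3_one, mk3_two, mul_pow, div_pow, sgn_sq, cc_sq hvc, neg_sq]
    field_simp
    ring
  rw [edgePlusDensity, hangle, hnorm]
  ring

/-! ### The integrated mean curvature -/

/-- The fundamental theorem of calculus for a nonnegative, possibly unbounded derivative. -/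
lemma integral_Ioo_of_nonneg_deriv {a b : ℝ} {F f : ℝ → ℝ} (hab : a ≤ b)
    (hc : ContinuousOn F (Icc a b)) (hd : ∀ x ∈ Ioo a b, HasDerivAt F (f x) x)
    (hp : ∀ x ∈ Ioo a b, 0 ≤ f x) :
    IntegrableOn f (Ioo a b) ∧ ∫ x in Ioo a b, f x = F b - F a := by
  have h := intervalIntegral.integrableOn_deriv_of_nonneg hc hd hp
  refine ⟨h.mono_set Ioo_subset_Ioc_self, ?_⟩
  rw [← integral_Ioc_eq_integral_Ioo, ← intervalIntegral.integral_of_le hab]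
  exact intervalIntegral.integral_eq_sub_of_hasDerivAt_of_le hab hc hd
    ((intervalIntegrable_iff_integrableOn_Ioc_of_le hab).2 h)

lemma continuous_ca : Continuous ca := by unfold ca; fun_prop

lemma continuous_cc : Continuous cc := by unfold cc; fun_prop

lemma normSq_pos (v : ℝ) : 0 < 1 + 2 * v + 3 * v ^ 2 := by
  nlinarith [sq_nonneg (1 + 3 * v)]

/-- An antiderivative of the curvature density. -/
lemma hasDerivAt_arcsin_ruleNormal {v : ℝ} (hv : v ∈ Ioo (-2 : ℝ) (-2 / 3)) :
    HasDerivAt (fun r => (1 / Real.sqrt 2) *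
        Real.arcsin (3 * (1 + r) / Real.sqrt (1 + 2 * r + 3 * r ^ 2)))
      (3 * v ^ 2 / (ca v * cc v * (1 + 2 * v + 3 * v ^ 2))) v := by
  have hvc := Ioo_subset_Icc_self hv
  have ha := ca_pos hv
  have hc := cc_pos hv
  have hv0 : v < 0 := by linarith [hv.2]
  have hN := normSq_pos v
  set n := Real.sqrt (1 + 2 * v + 3 * v ^ 2) with hn
  have hn0 : 0 < n := Real.sqrt_pos.2 hN
  have hn2 : n ^ 2 = 1 + 2 * v + 3 * v ^ 2 := Real.sq_sqrt hN.le
  have hq : HasDerivAt (fun r : ℝ => 1 + 2 * r + 3 * r ^ 2) (2 * 1 + 3 * (2 * v)) v := by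
    have h1 := (((hasDerivAt_id v).const_mul 2).const_add 1).add
      (((hasDerivAt_id v).pow 2).const_mul 3)
    convert! h1 using 1
    simp
  have hx : HasDerivAt (fun r => 3 * (1 + r) / Real.sqrt (1 + 2 * r + 3 * r ^ 2))
      (-6 * v / n ^ 3) v := by
    have h1 := (((hasDerivAt_id v).const_add 1).const_mul 3).div (hq.sqrt hN.ne') hn0.ne'
    convert! h1 using 1
    simp only [id]
    rw [← hn]
    field_simp
    rw [hn2]
    ring
  have hprod : (ca v * cc v) ^ 2 = -v ^ 2 * ((2 + v) * (2 + 3 * v)) := by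
    rw [mul_pow, ca_sq hvc, cc_sq hvc]; ring
  have h1x : Real.sqrt (1 - (3 * (1 + v) / n) ^ 2) =
      Real.sqrt 2 * (ca v * cc v) / (-v * n) := by
    have h2 : Real.sqrt 2 ^ 2 = 2 := Real.sq_sqrt zero_le_two
    rw [Real.sqrt_eq_iff_mul_self_eq_of_pos (div_pos (by positivity) (by nlinarith)), ← sq,
      div_pow, mul_pow, h2, hprod, div_pow, mul_pow]
    have hv1 := hv0.ne
    field_simp
    linear_combination -hn2
  have hpos : 0 < 1 - (3 * (1 + v) / n) ^ 2 := by
    refine Real.sqrt_pos.1 ?_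
    rw [h1x]
    exact div_pos (by positivity) (by nlinarith)
  have habs := abs_lt.1 ((sq_lt_one_iff_abs_lt_one _).1 (by linarith : (3 * (1 + v) / n) ^ 2 < 1))
  have := ((Real.hasDerivAt_arcsin habs.1.ne' habs.2.ne).comp v hx).const_mul (1 / Real.sqrt 2)
  convert! this using 1
  have h2 : Real.sqrt 2 ^ 2 = 2 := Real.sq_sqrt zero_le_two
  have h20 : Real.sqrt 2 ≠ 0 := by positivity
  rw [h1x, ← hn2]
  have hv1 := hv0.ne
  field_simp
  rw [h2]
  norm_num

lemma integral_curvature :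
    IntegrableOn (fun v => 3 * v ^ 2 / (ca v * cc v * (1 + 2 * v + 3 * v ^ 2)))
      (Ioo (-2 : ℝ) (-2 / 3)) ∧
    ∫ v in Ioo (-2 : ℝ) (-2 / 3), 3 * v ^ 2 / (ca v * cc v * (1 + 2 * v + 3 * v ^ 2)) =
      Real.pi / Real.sqrt 2 := by
  have h := integral_Ioo_of_nonneg_deriv (a := -2) (b := -2 / 3) (by norm_num)
    (F := fun r => (1 / Real.sqrt 2) *
      Real.arcsin (3 * (1 + r) / Real.sqrt (1 + 2 * r + 3 * r ^ 2)))
    (by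
      refine (continuous_const.mul (Real.continuous_arcsin.comp
        (Continuous.div (by fun_prop) (by fun_prop) fun r => ?_))).continuousOn
      exact (Real.sqrt_pos.2 (normSq_pos r)).ne')
    (fun v hv => hasDerivAt_arcsin_ruleNormal hv)
    (fun v hv => by
      have := ca_pos hv
      have := cc_pos hv
      have := normSq_pos v
      positivity)
  refine ⟨h.1, h.2.trans ?_⟩
  have h1 : Real.sqrt (1 + 2 * (-2 / 3) + 3 * (-2 / 3) ^ 2) = 1 := by norm_num
  have h2 : Real.sqrt (1 + 2 * (-2) + 3 * (-2) ^ 2) = 3 := by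
    rw [show (1 : ℝ) + 2 * (-2) + 3 * (-2) ^ 2 = 3 ^ 2 by norm_num]
    exact Real.sqrt_sq (by norm_num)
  simp only [h1, h2]
  norm_num
  ring

lemma volume_restrict_openRect :
    (volume : Measure (ℝ × ℝ)).restrict openRect =
      (volume.restrict (Ioo (0 : ℝ) 1)).prod (volume.restrict (Ioo (-2 : ℝ) (-2 / 3))) := by
  rw [openRect, Measure.prod_restrict]
  rfl

lemma measurableSet_openRect : MeasurableSet openRect :=
  measurableSet_Ioo.prod measurableSet_Ioo

lemma integrableOn_curvatureDensity (s t : ℤˣ) :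
    IntegrableOn (curvatureDensity s t) openRect := by
  refine IntegrableOn.congr_fun ?_ (fun q hq => (curvatureDensity_eq s t hq).symm)
    measurableSet_openRect
  rw [IntegrableOn, volume_restrict_openRect]
  exact Integrable.comp_snd integral_curvature.1 _

lemma integral_curvatureDensity (s t : ℤˣ) :
    ∫ q in openRect, curvatureDensity s t q = Real.pi / Real.sqrt 2 := by
  rw [setIntegral_congr_fun measurableSet_openRect (fun q hq => curvatureDensity_eq s t hq),
    volume_restrict_openRect,
    integral_fun_snd (fun v : ℝ => 3 * v ^ 2 / (ca v * cc v * (1 + 2 * v + 3 * v ^ 2))),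
    integral_curvature.2]
  simp

lemma sum_units_const (x : ℝ) : ∑ _s : ℤˣ, x = 2 * x := by
  rw [Finset.sum_const, Finset.card_univ, Fintype.card_units_int, nsmul_eq_mul]
  norm_num

lemma integratedMeanCurvature_eq : integratedMeanCurvature = 2 * Real.sqrt 2 * Real.pi := by
  simp only [integratedMeanCurvature, integral_curvatureDensity, sum_units_const]
  have h2 : Real.sqrt 2 ^ 2 = 2 := Real.sq_sqrt zero_le_two
  have h20 : Real.sqrt 2 ≠ 0 := by positivity
  field_simp
  rw [h2]

/-! ### The edge integral as an iterated integral -/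

/-- For `m = (q s² - r) / (δ s)` one has
`(q s² + r) ds / ((q s² - r)² + δ² s²) = δ⁻¹ dm / (1 + m²)`, and `m` runs over the whole line. -/
lemma integral_symmetrized {q r δ : ℝ} (hq : 0 < q) (hr : 0 < r) (hδ : 0 < δ) :
    IntegrableOn (fun s => (q * s ^ 2 + r) / ((q * s ^ 2 - r) ^ 2 + δ ^ 2 * s ^ 2)) (Ioi 0) ∧
    ∫ s in Ioi (0 : ℝ), (q * s ^ 2 + r) / ((q * s ^ 2 - r) ^ 2 + δ ^ 2 * s ^ 2) =
      Real.pi / δ := by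
  set m : ℝ → ℝ := fun s => (q * s ^ 2 - r) / (δ * s) with hm
  have hderiv : ∀ s ∈ Ioi (0 : ℝ),
      HasDerivWithinAt m ((q * s ^ 2 + r) / (δ * s ^ 2)) (Ioi 0) s := by
    intro s hs
    have hs0 : s ≠ 0 := ne_of_gt hs
    refine HasDerivAt.hasDerivWithinAt ?_
    have h := ((((hasDerivAt_id s).pow 2).const_mul q).sub_const r).div
      ((hasDerivAt_id s).const_mul δ) (mul_ne_zero hδ.ne' hs0)
    convert! h using 1
    simp
    field_simp
    ring
  have hmono : StrictMonoOn m (Ioi 0) := by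
    intro s hs t ht hst
    simp only [mem_Ioi] at hs ht
    simp only [hm]
    rw [div_lt_div_iff₀ (by positivity) (by positivity)]
    have h1 : 0 < δ * (t - s) * (q * s * t + r) := by
      have := sub_pos.2 hst
      positivity
    nlinarith
  have himage : m '' Ioi 0 = univ := by
    refine eq_univ_of_forall fun y => ?_
    have hd : 0 ≤ δ ^ 2 * y ^ 2 + 4 * q * r := by positivity
    have h1 := Real.sq_sqrt hd
    set z := Real.sqrt (δ ^ 2 * y ^ 2 + 4 * q * r) with hz
    have h2 : |δ * y| < z := by
      rw [← Real.sqrt_sq_eq_abs]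
      refine Real.sqrt_lt_sqrt (by positivity) ?_
      rw [mul_pow]
      linarith [mul_pos hq hr]
    have h3 : 0 < δ * y + z := by linarith [(abs_lt.1 h2).1]
    have h4 : 0 < (δ * y + z) / (2 * q) := by positivity
    refine ⟨(δ * y + z) / (2 * q), h4, ?_⟩
    simp only [hm]
    rw [div_eq_iff (by positivity)]
    field_simp
    linear_combination h1
  have hcongr : EqOn (fun s => |(q * s ^ 2 + r) / (δ * s ^ 2)| • (1 + m s ^ 2)⁻¹)
      (fun s => δ * ((q * s ^ 2 + r) / ((q * s ^ 2 - r) ^ 2 + δ ^ 2 * s ^ 2))) (Ioi 0) := by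
    intro s hs
    have hs : 0 < s := hs
    simp only [hm, smul_eq_mul]
    rw [abs_of_pos (by positivity)]
    have h1 : 0 < (q * s ^ 2 - r) ^ 2 + δ ^ 2 * s ^ 2 := by positivity
    have h2 : 1 + ((q * s ^ 2 - r) / (δ * s)) ^ 2 =
        ((q * s ^ 2 - r) ^ 2 + δ ^ 2 * s ^ 2) / (δ * s) ^ 2 := by
      field_simp
      ring
    rw [h2, inv_div]
    field_simp
  have hint := integrableOn_image_iff_integrableOn_abs_deriv_smul measurableSet_Ioi hderiv
    hmono.injOn (fun y => (1 + y ^ 2)⁻¹)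
  have heq := integral_image_eq_integral_abs_deriv_smul measurableSet_Ioi hderiv
    hmono.injOn (fun y => (1 + y ^ 2)⁻¹)
  rw [himage] at hint heq
  rw [setIntegral_univ, integral_univ_inv_one_add_sq,
    setIntegral_congr_fun measurableSet_Ioi hcongr, integral_const_mul] at heq
  have h1 := hint.1 integrable_inv_one_add_sq.integrableOn
  rw [integrableOn_congr_fun hcongr measurableSet_Ioi] at h1
  constructor
  · refine (h1.const_mul δ⁻¹).congr (Filter.Eventually.of_forall fun s => ?_)
    simp only
    rw [inv_mul_cancel_left₀ hδ.ne']
  · rw [heq, mul_div_cancel_left₀ _ hδ.ne']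

/-- The substitution `s ↦ r / (q s)` exchanges the two summands of the numerator in
`integral_symmetrized`. -/
lemma integral_sq_div {q r δ : ℝ} (hq : 0 < q) (hr : 0 < r) (hδ : 0 < δ) :
    ∫ s in Ioi (0 : ℝ), s ^ 2 / ((q * s ^ 2 - r) ^ 2 + δ ^ 2 * s ^ 2) =
      Real.pi / (2 * q * δ) := by
  obtain ⟨hint, heq⟩ := integral_symmetrized hq hr hδ
  set D : ℝ → ℝ := fun s => (q * s ^ 2 - r) ^ 2 + δ ^ 2 * s ^ 2 with hD
  have hDpos : ∀ s ∈ Ioi (0 : ℝ), 0 < D s := fun s hs => by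
    have hs : 0 < s := hs
    simp only [hD]
    positivity
  have hmeas : Measurable D := by
    simp only [hD]
    fun_prop
  have hi1 : IntegrableOn (fun s => s ^ 2 / D s) (Ioi 0) := by
    refine Integrable.mono' (hint.const_mul q⁻¹)
      ((measurable_id.pow_const 2).div hmeas).aestronglyMeasurable ?_
    filter_upwards [ae_restrict_mem measurableSet_Ioi] with s hs
    have := hDpos s hs
    rw [Real.norm_of_nonneg (by positivity), ← mul_div_assoc]
    gcongr
    rw [mul_add, inv_mul_cancel_left₀ hq.ne']
    have : 0 < q⁻¹ * r := by positivity
    linarith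
  have hi2 : IntegrableOn (fun s => r / D s) (Ioi 0) := by
    refine Integrable.mono' hint (measurable_const.div hmeas).aestronglyMeasurable ?_
    filter_upwards [ae_restrict_mem measurableSet_Ioi] with s hs
    have := hDpos s hs
    rw [Real.norm_of_nonneg (by positivity)]
    change r / D s ≤ (q * s ^ 2 + r) / D s
    gcongr
    have : 0 ≤ q * s ^ 2 := by positivity
    linarith
  have hswap : ∫ s in Ioi (0 : ℝ), r / D s = ∫ s in Ioi (0 : ℝ), q * (s ^ 2 / D s) := by
    have hderiv : ∀ s ∈ Ioi (0 : ℝ),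
        HasDerivWithinAt (fun s => r / (q * s)) (-(r / (q * s ^ 2))) (Ioi 0) s := by
      intro s hs
      have hs0 : s ≠ 0 := ne_of_gt hs
      refine HasDerivAt.hasDerivWithinAt ?_
      have h := (hasDerivAt_const s r).div ((hasDerivAt_id s).const_mul q)
        (mul_ne_zero hq.ne' hs0)
      convert! h using 1
      simp
      field_simp
    have hinj : InjOn (fun s => r / (q * s)) (Ioi (0 : ℝ)) := by
      intro s hs t ht hst
      have hs : 0 < s := hs
      have ht : 0 < t := ht
      simp only at hst
      rw [div_eq_div_iff (by positivity) (by positivity)] at hst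
      have := mul_left_cancel₀ hr.ne' hst
      exact (mul_left_cancel₀ hq.ne' this).symm
    have himage : (fun s => r / (q * s)) '' Ioi (0 : ℝ) = Ioi 0 := by
      apply Subset.antisymm
      · rintro _ ⟨s, hs, rfl⟩
        have hs : 0 < s := hs
        exact div_pos hr (by positivity)
      · intro y hy
        have hy : 0 < y := hy
        refine ⟨r / (q * y), div_pos hr (by positivity), ?_⟩
        simp only
        field_simp
    have h := integral_image_eq_integral_abs_deriv_smul measurableSet_Ioi hderiv hinj
      (fun s => r / D s)
    rw [himage] at h
    rw [h]
    refine setIntegral_congr_fun measurableSet_Ioi fun s hs => ?_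
    have hs' : 0 < s := hs
    have h1 := hDpos s hs
    have h2 : D (r / (q * s)) = (r / (q * s ^ 2)) ^ 2 * D s := by
      simp only [hD]
      field_simp
      ring
    simp only [smul_eq_mul]
    rw [abs_neg, abs_of_pos (by positivity), h2]
    field_simp
  have hsum : ∫ s in Ioi (0 : ℝ), (q * s ^ 2 + r) / D s =
      2 * q * ∫ s in Ioi (0 : ℝ), s ^ 2 / D s := by
    have h1 : ∀ s, (q * s ^ 2 + r) / D s = q * (s ^ 2 / D s) + r / D s := fun s => by ring
    simp only [h1]
    rw [integral_add (hi1.const_mul q) hi2, hswap, integral_const_mul]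
    ring
  have h3 := hsum.symm.trans heq
  rw [← div_div, eq_div_iff hδ.ne', eq_div_iff (by positivity)]
  rw [eq_div_iff hδ.ne'] at h3
  linarith

/-- The integrand of the iterated integral that represents the edge integral. -/
noncomputable def edgeKernel (s k : ℝ) : ℝ :=
  16 * s ^ 2 / ((3 + s ^ 2) ^ 2 + 8 * k ^ 2 * s ^ 2 * (1 + s ^ 2))

/-- The edge integrand `α ds` in the parameter `s`, for which the `y`-coordinate on the circle
bounding `diskMinus` is `-(2 + 2 s²) / (3 + s²)`. -/
noncomputable def edgeIntegrand (s : ℝ) : ℝ :=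
  2 * Real.arctan (s * Real.sqrt (8 * (1 + s ^ 2)) / (3 + s ^ 2)) *
    (8 * s / ((3 + s ^ 2) * Real.sqrt (8 * (1 + s ^ 2))))

/-- With `q = √(1 + 8 k²)` the denominator of `edgeKernel` is `(q s² - 3)² + (q + 1) (q + 5) s²`. -/
lemma integral_edgeKernel_left (k : ℝ) :
    ∫ s in Ioi (0 : ℝ), edgeKernel s k =
      8 * Real.pi / (Real.sqrt (1 + 8 * k ^ 2) *
        Real.sqrt ((Real.sqrt (1 + 8 * k ^ 2) + 1) * (Real.sqrt (1 + 8 * k ^ 2) + 5))) := by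
  have hq2 : Real.sqrt (1 + 8 * k ^ 2) ^ 2 = 1 + 8 * k ^ 2 := Real.sq_sqrt (by positivity)
  have hq : 0 < Real.sqrt (1 + 8 * k ^ 2) := Real.sqrt_pos.2 (by positivity)
  set q := Real.sqrt (1 + 8 * k ^ 2)
  have hδ2 : Real.sqrt ((q + 1) * (q + 5)) ^ 2 = (q + 1) * (q + 5) := Real.sq_sqrt (by positivity)
  have hδ : 0 < Real.sqrt ((q + 1) * (q + 5)) := Real.sqrt_pos.2 (by positivity)
  set δ := Real.sqrt ((q + 1) * (q + 5))
  have h : ∀ s, edgeKernel s k = 16 * (s ^ 2 / ((q * s ^ 2 - 3) ^ 2 + δ ^ 2 * s ^ 2)) := by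
    intro s
    rw [edgeKernel, mul_div_assoc]
    congr 2
    rw [hδ2]
    linear_combination (-s ^ 2 - s ^ 4) * hq2
  simp only [h]
  rw [integral_const_mul, integral_sq_div hq zero_lt_three hδ]
  field_simp
  norm_num

/-- An antiderivative of the remaining integrand in the parameter `k`. -/
lemma hasDerivAt_arcsin_edge {k : ℝ} (hk : k ∈ Ioo (0 : ℝ) 1) :
    HasDerivAt (fun k => -Real.pi * Real.arcsin
        ((7 - Real.sqrt (1 + 8 * k ^ 2)) / (3 * (Real.sqrt (1 + 8 * k ^ 2) + 1))))
      (8 * Real.pi / (Real.sqrt (1 + 8 * k ^ 2) *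
        Real.sqrt ((Real.sqrt (1 + 8 * k ^ 2) + 1) * (Real.sqrt (1 + 8 * k ^ 2) + 5)))) k := by
  have hk0 : 0 < k := hk.1
  have hq2 : Real.sqrt (1 + 8 * k ^ 2) ^ 2 = 1 + 8 * k ^ 2 := Real.sq_sqrt (by positivity)
  have hq : 0 < Real.sqrt (1 + 8 * k ^ 2) := Real.sqrt_pos.2 (by positivity)
  have hdq : HasDerivAt (fun k : ℝ => Real.sqrt (1 + 8 * k ^ 2))
      (8 * k / Real.sqrt (1 + 8 * k ^ 2)) k := by
    have h := ((((hasDerivAt_id k).pow 2).const_mul 8).const_add 1).sqrt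
      (by simp only [id, Pi.pow_apply]; positivity)
    convert! h using 1
    simp
    field_simp
  set q := Real.sqrt (1 + 8 * k ^ 2) with hqdef
  have hδ2 : Real.sqrt ((q + 1) * (q + 5)) ^ 2 = (q + 1) * (q + 5) := Real.sq_sqrt (by positivity)
  have hδ : 0 < Real.sqrt ((q + 1) * (q + 5)) := Real.sqrt_pos.2 (by positivity)
  set δ := Real.sqrt ((q + 1) * (q + 5))
  have hx : HasDerivAt (fun k : ℝ => (7 - Real.sqrt (1 + 8 * k ^ 2)) /
      (3 * (Real.sqrt (1 + 8 * k ^ 2) + 1))) (-(64 * k) / (3 * q * (q + 1) ^ 2)) k := by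
    have h := (hdq.const_sub 7).div ((hdq.add_const 1).const_mul 3)
      (by rw [← hqdef]; positivity)
    convert! h using 1
    rw [← hqdef]
    field_simp
    ring
  have h1x : Real.sqrt (1 - ((7 - q) / (3 * (q + 1))) ^ 2) = 8 * k * δ / (3 * (q + 1) ^ 2) := by
    rw [Real.sqrt_eq_iff_mul_self_eq_of_pos (by positivity), ← sq, div_pow, mul_pow, hδ2, mul_pow,
      div_pow]
    have hk2 : k ^ 2 = (q ^ 2 - 1) / 8 := by linarith
    rw [hk2]
    field_simp
    ring
  have hpos : 0 < 1 - ((7 - q) / (3 * (q + 1))) ^ 2 := by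
    refine Real.sqrt_pos.1 ?_
    rw [h1x]
    positivity
  have habs := abs_lt.1 ((sq_lt_one_iff_abs_lt_one _).1
    (by linarith : ((7 - q) / (3 * (q + 1))) ^ 2 < 1))
  have h := ((Real.hasDerivAt_arcsin habs.1.ne' habs.2.ne).comp k hx).const_mul (-Real.pi)
  convert! h using 1
  rw [h1x]
  field_simp
  norm_num

lemma integral_arccos :
    ∫ k in Ioo (0 : ℝ) 1, 8 * Real.pi / (Real.sqrt (1 + 8 * k ^ 2) *
        Real.sqrt ((Real.sqrt (1 + 8 * k ^ 2) + 1) * (Real.sqrt (1 + 8 * k ^ 2) + 5))) =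
      Real.pi * arcsec 3 := by
  have h := integral_Ioo_of_nonneg_deriv (a := 0) (b := 1) zero_le_one
    (F := fun k => -Real.pi * Real.arcsin
        ((7 - Real.sqrt (1 + 8 * k ^ 2)) / (3 * (Real.sqrt (1 + 8 * k ^ 2) + 1))))
    (by
      refine (continuous_const.mul (Real.continuous_arcsin.comp
        (Continuous.div (by fun_prop) (by fun_prop) fun r => ?_))).continuousOn
      have := Real.sqrt_nonneg (1 + 8 * r ^ 2)
      positivity)
    (fun v hv => hasDerivAt_arcsin_edge hv)
    (fun v hv => by positivity)
  rw [h.2, arcsec, Real.arccos]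
  have h3 : Real.sqrt (1 + 8 * 1 ^ 2) = 3 := by
    rw [show (1 : ℝ) + 8 * 1 ^ 2 = 3 ^ 2 by norm_num]
    exact Real.sqrt_sq (by norm_num)
  have h1 : Real.sqrt (1 + 8 * 0 ^ 2) = 1 := by norm_num
  simp only [h1, h3]
  norm_num
  ring

/-- The identity `arctan x = ∫ x dk / (1 + k² x²)` over `0 < k < 1`, applied to the angle. -/
lemma edgeIntegrand_eq {s : ℝ} (hs : 0 < s) :
    edgeIntegrand s = ∫ k in Ioo (0 : ℝ) 1, edgeKernel s k := by
  set R := Real.sqrt (8 * (1 + s ^ 2)) with hR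
  have hR0 : 0 < R := Real.sqrt_pos.2 (by positivity)
  have hR2 : R ^ 2 = 8 * (1 + s ^ 2) := Real.sq_sqrt (by positivity)
  have h := integral_Ioo_of_nonneg_deriv (a := 0) (b := 1) (f := edgeKernel s) zero_le_one
    (F := fun k => 2 * Real.arctan (k * (s * R / (3 + s ^ 2))) * (8 * s / ((3 + s ^ 2) * R)))
    (by fun_prop)
    (fun k hk => by
      have h1 := (((hasDerivAt_id k).mul_const (s * R / (3 + s ^ 2))).arctan.const_mul
        2).mul_const (8 * s / ((3 + s ^ 2) * R))
      convert! h1 using 1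
      simp only [id, edgeKernel]
      have h3 : 0 < 3 + s ^ 2 := by positivity
      have h2 : 1 + (k * (s * R / (3 + s ^ 2))) ^ 2 =
          ((3 + s ^ 2) ^ 2 + 8 * k ^ 2 * s ^ 2 * (1 + s ^ 2)) / (3 + s ^ 2) ^ 2 := by
        rw [mul_pow, div_pow, mul_pow, hR2]
        field_simp
      rw [h2]
      field_simp
      norm_num)
    (fun k hk => by rw [edgeKernel]; positivity)
  rw [h.2, edgeIntegrand, ← hR]
  simp only [one_mul, zero_mul, Real.arctan_zero, mul_zero, sub_zero]

lemma integrable_edgeKernel :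
    Integrable (Function.uncurry edgeKernel)
      ((volume.restrict (Ioi (0 : ℝ))).prod (volume.restrict (Ioo (0 : ℝ) 1))) := by
  have hb : Integrable (fun p : ℝ × ℝ => 16 * (1 + p.1 ^ 2)⁻¹)
      ((volume.restrict (Ioi (0 : ℝ))).prod (volume.restrict (Ioo (0 : ℝ) 1))) :=
    ((integrable_inv_one_add_sq.integrableOn (s := Ioi (0 : ℝ))).const_mul 16).comp_fst _
  refine hb.mono' ?_ (Filter.Eventually.of_forall fun p => ?_)
  · refine Measurable.aestronglyMeasurable ?_
    unfold Function.uncurry edgeKernel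
    fun_prop
  · obtain ⟨s, k⟩ := p
    simp only [Function.uncurry, edgeKernel]
    rw [Real.norm_of_nonneg (by positivity), ← div_eq_mul_inv,
      div_le_div_iff₀ (by positivity) (by positivity)]
    have : 0 ≤ 8 * k ^ 2 * s ^ 2 * (1 + s ^ 2) := by positivity
    nlinarith [sq_nonneg s]

lemma integrableOn_edgeIntegrand : IntegrableOn edgeIntegrand (Ioi 0) := by
  refine IntegrableOn.congr_fun (f := fun s => ∫ k in Ioo (0 : ℝ) 1, edgeKernel s k) ?_
    (fun s hs => (edgeIntegrand_eq hs).symm) measurableSet_Ioi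
  exact integrable_edgeKernel.integral_prod_left

/-- Fubini's theorem, with the integral over `s` done first. -/
lemma integral_edgeIntegrand : ∫ s in Ioi (0 : ℝ), edgeIntegrand s = Real.pi * arcsec 3 := by
  rw [setIntegral_congr_fun measurableSet_Ioi (fun s hs => edgeIntegrand_eq hs),
    integral_integral_swap integrable_edgeKernel,
    setIntegral_congr_fun measurableSet_Ioo (fun k _ => integral_edgeKernel_left k),
    integral_arccos]

/-! ### The edge integrals -/

/-- The substitution `v = -(2 + 2 s²) / (3 + s²)` rationalizes the quotient `cc v / ca v = s`. -/
lemma edgeMinus_substitution :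
    IntegrableOn (fun v => 2 * Real.arctan (cc v) / ca v) (Ioo (-2 : ℝ) (-2 / 3)) ∧
      ∫ v in Ioo (-2 : ℝ) (-2 / 3), 2 * Real.arctan (cc v) / ca v = Real.pi * arcsec 3 := by
  set f : ℝ → ℝ := fun s => -(2 + 2 * s ^ 2) / (3 + s ^ 2) with hf
  have hderiv : ∀ s ∈ Ioi (0 : ℝ), HasDerivWithinAt f (-(8 * s) / (3 + s ^ 2) ^ 2) (Ioi 0) s := by
    intro s hs
    refine HasDerivAt.hasDerivWithinAt ?_
    have h := ((((hasDerivAt_id s).pow 2).const_mul 2).const_add 2).neg.div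
      (((hasDerivAt_id s).pow 2).const_add 3) (by simp only [id, Pi.pow_apply]; positivity)
    convert! h using 1
    simp
    field_simp
    ring
  have hinj : InjOn f (Ioi 0) := by
    intro s hs t ht hst
    have hs : 0 < s := hs
    have ht : 0 < t := ht
    simp only [hf] at hst
    rw [div_eq_div_iff (by positivity) (by positivity)] at hst
    exact (sq_eq_sq₀ hs.le ht.le).1 (by linarith)
  have himage : f '' Ioi 0 = Ioo (-2 : ℝ) (-2 / 3) := by
    apply Subset.antisymm
    · rintro _ ⟨s, hs, rfl⟩
      have hs : 0 < s := hs
      simp only [hf]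
      constructor
      · rw [lt_div_iff₀ (by positivity)]
        linarith
      · rw [div_lt_iff₀ (by positivity)]
        have : 0 < s ^ 2 := by positivity
        linarith
    · rintro v ⟨hv1, hv2⟩
      have h1 : 0 < 2 + v := by linarith
      have h2 : 0 < (-2 - 3 * v) / (2 + v) := div_pos (by linarith) h1
      refine ⟨Real.sqrt ((-2 - 3 * v) / (2 + v)), Real.sqrt_pos.2 h2, ?_⟩
      simp only [hf]
      rw [Real.sq_sqrt h2.le, div_eq_iff (by positivity)]
      field_simp
      ring
  have hcongr : EqOn (fun s => |-(8 * s) / (3 + s ^ 2) ^ 2| •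
      (2 * Real.arctan (cc (f s)) / ca (f s))) edgeIntegrand (Ioi 0) := by
    intro s hs
    have hs : 0 < s := hs
    set R := Real.sqrt (8 * (1 + s ^ 2)) with hR
    have hR0 : 0 < R := Real.sqrt_pos.2 (by positivity)
    have hR2 : R ^ 2 = 8 * (1 + s ^ 2) := Real.sq_sqrt (by positivity)
    have ha : ca (f s) = R / (3 + s ^ 2) := by
      rw [ca, Real.sqrt_eq_iff_mul_self_eq_of_pos (by positivity), ← sq, div_pow, hR2]
      simp only [hf]
      field_simp
      ring
    have hc : cc (f s) = s * R / (3 + s ^ 2) := by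
      rw [cc, Real.sqrt_eq_iff_mul_self_eq_of_pos (by positivity), ← sq, div_pow, mul_pow, hR2]
      simp only [hf]
      field_simp
      ring
    simp only [smul_eq_mul]
    rw [neg_div, abs_neg, abs_of_pos (by positivity), ha, hc, edgeIntegrand, ← hR]
    field_simp
  have hint := integrableOn_image_iff_integrableOn_abs_deriv_smul measurableSet_Ioi hderiv
    hinj (fun v => 2 * Real.arctan (cc v) / ca v)
  have heq := integral_image_eq_integral_abs_deriv_smul measurableSet_Ioi hderiv
    hinj (fun v => 2 * Real.arctan (cc v) / ca v)
  rw [himage] at hint heq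
  rw [hint, heq, integrableOn_congr_fun hcongr measurableSet_Ioi,
    setIntegral_congr_fun measurableSet_Ioi hcongr]
  exact ⟨integrableOn_edgeIntegrand, integral_edgeIntegrand⟩

/-- The substitution `v = -(2 + 2 s²) / (1 + 3 s²)` rationalizes the quotient `ca v / cc v = s`. The
resulting integrand is that of `edgeMinus_substitution`, since the two disks are congruent. -/
lemma edgePlus_substitution :
    IntegrableOn (fun v => 2 * Real.arctan (ca v / -(1 + 2 * v)) / (cc v * -(1 + 2 * v)))
      (Ioo (-2 : ℝ) (-2 / 3)) ∧
      ∫ v in Ioo (-2 : ℝ) (-2 / 3),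
        2 * Real.arctan (ca v / -(1 + 2 * v)) / (cc v * -(1 + 2 * v)) = Real.pi * arcsec 3 := by
  set f : ℝ → ℝ := fun s => -(2 + 2 * s ^ 2) / (1 + 3 * s ^ 2) with hf
  have hderiv : ∀ s ∈ Ioi (0 : ℝ), HasDerivWithinAt f (8 * s / (1 + 3 * s ^ 2) ^ 2) (Ioi 0) s := by
    intro s hs
    refine HasDerivAt.hasDerivWithinAt ?_
    have h := ((((hasDerivAt_id s).pow 2).const_mul 2).const_add 2).neg.div
      ((((hasDerivAt_id s).pow 2).const_mul 3).const_add 1)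
      (by simp only [id, Pi.pow_apply]; positivity)
    convert! h using 1
    simp
    field_simp
    ring
  have hinj : InjOn f (Ioi 0) := by
    intro s hs t ht hst
    have hs : 0 < s := hs
    have ht : 0 < t := ht
    simp only [hf] at hst
    rw [div_eq_div_iff (by positivity) (by positivity)] at hst
    exact (sq_eq_sq₀ hs.le ht.le).1 (by linarith)
  have himage : f '' Ioi 0 = Ioo (-2 : ℝ) (-2 / 3) := by
    apply Subset.antisymm
    · rintro _ ⟨s, hs, rfl⟩
      have hs : 0 < s := hs
      have : 0 < s ^ 2 := by positivity
      simp only [hf]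
      constructor
      · rw [lt_div_iff₀ (by positivity)]
        linarith
      · rw [div_lt_iff₀ (by positivity)]
        linarith
    · rintro v ⟨hv1, hv2⟩
      have h1 : 0 < -2 - 3 * v := by linarith
      have h2 : 0 < (2 + v) / (-2 - 3 * v) := div_pos (by linarith) h1
      refine ⟨Real.sqrt ((2 + v) / (-2 - 3 * v)), Real.sqrt_pos.2 h2, ?_⟩
      simp only [hf]
      rw [Real.sq_sqrt h2.le, div_eq_iff (by positivity)]
      have h3 : -2 - v * 3 ≠ 0 := by rw [mul_comm v]; exact h1.ne'
      field_simp
      ring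
  have hcongr : EqOn (fun s => |8 * s / (1 + 3 * s ^ 2) ^ 2| •
      (2 * Real.arctan (ca (f s) / -(1 + 2 * f s)) / (cc (f s) * -(1 + 2 * f s))))
      edgeIntegrand (Ioi 0) := by
    intro s hs
    have hs : 0 < s := hs
    set R := Real.sqrt (8 * (1 + s ^ 2)) with hR
    have hR0 : 0 < R := Real.sqrt_pos.2 (by positivity)
    have hR2 : R ^ 2 = 8 * (1 + s ^ 2) := Real.sq_sqrt (by positivity)
    have ha : ca (f s) = s * R / (1 + 3 * s ^ 2) := by
      rw [ca, Real.sqrt_eq_iff_mul_self_eq_of_pos (by positivity), ← sq, div_pow, mul_pow, hR2]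
      simp only [hf]
      field_simp
      ring
    have hc : cc (f s) = R / (1 + 3 * s ^ 2) := by
      rw [cc, Real.sqrt_eq_iff_mul_self_eq_of_pos (by positivity), ← sq, div_pow, hR2]
      simp only [hf]
      field_simp
      ring
    have hw : -(1 + 2 * f s) = (3 + s ^ 2) / (1 + 3 * s ^ 2) := by
      simp only [hf]
      field_simp
      ring
    simp only [smul_eq_mul]
    rw [abs_of_pos (by positivity), ha, hc, hw, edgeIntegrand, ← hR,
      div_div_div_cancel_right₀ (by positivity)]
    field_simp
  have hint := integrableOn_image_iff_integrableOn_abs_deriv_smul measurableSet_Ioi hderiv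
    hinj (fun v => 2 * Real.arctan (ca v / -(1 + 2 * v)) / (cc v * -(1 + 2 * v)))
  have heq := integral_image_eq_integral_abs_deriv_smul measurableSet_Ioi hderiv
    hinj (fun v => 2 * Real.arctan (ca v / -(1 + 2 * v)) / (cc v * -(1 + 2 * v)))
  rw [himage] at hint heq
  rw [hint, heq, integrableOn_congr_fun hcongr measurableSet_Ioi,
    setIntegral_congr_fun measurableSet_Ioi hcongr]
  exact ⟨integrableOn_edgeIntegrand, integral_edgeIntegrand⟩

lemma integrableOn_edgeMinusDensity (s : ℤˣ) :
    IntegrableOn (edgeMinusDensity s) (Ioo (-2 : ℝ) (-2 / 3)) :=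
  edgeMinus_substitution.1.congr_fun (fun _ hv => (edgeMinusDensity_eq s hv).symm)
    measurableSet_Ioo

lemma integral_edgeMinusDensity (s : ℤˣ) :
    ∫ v in Ioo (-2 : ℝ) (-2 / 3), edgeMinusDensity s v = Real.pi * arcsec 3 := by
  rw [setIntegral_congr_fun measurableSet_Ioo (fun v hv => edgeMinusDensity_eq s hv),
    edgeMinus_substitution.2]

lemma integrableOn_edgePlusDensity (t : ℤˣ) :
    IntegrableOn (edgePlusDensity t) (Ioo (-2 : ℝ) (-2 / 3)) :=
  edgePlus_substitution.1.congr_fun (fun _ hv => (edgePlusDensity_eq t hv).symm)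
    measurableSet_Ioo

lemma integral_edgePlusDensity (t : ℤˣ) :
    ∫ v in Ioo (-2 : ℝ) (-2 / 3), edgePlusDensity t v = Real.pi * arcsec 3 := by
  rw [setIntegral_congr_fun measurableSet_Ioo (fun v hv => edgePlusDensity_eq t hv),
    edgePlus_substitution.2]

lemma edgeTerm_eq : edgeTerm = 4 * Real.pi * arcsec 3 := by
  simp only [edgeTerm, integral_edgeMinusDensity, integral_edgePlusDensity, sum_units_const]
  ring

/-! ### The one-dimensional integrals behind the mean width -/

/-- The mean-width integrand, in the parameter `v`. -/
noncomputable def widthIntegrand (v : ℝ) : ℝ :=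
  -v * (Real.arctan (cc v) + cc v / (1 + cc v ^ 2)) / ca v

lemma ca_mul_cc_lt {v : ℝ} (hv : v ∈ Icc (-2 : ℝ) (-2 / 3)) : ca v * cc v < 3 * v ^ 2 := by
  have h0 : v ≠ 0 := by have := hv.2; intro h; linarith
  refine lt_of_pow_lt_pow_left₀ 2 (by positivity) ?_
  rw [mul_pow, ca_sq hv, cc_sq hv]
  have := mul_pos (by positivity : 0 < v ^ 2) (normSq_pos v)
  nlinarith

/-- An auxiliary function that vanishes at both ends of `[-2, -2/3]`. Its derivative expresses
`widthIntegrand` through the edge integrand and the curvature density. -/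
noncomputable def widthPrimitive (v : ℝ) : ℝ :=
  ca v * Real.arctan (cc v) -
    (1 / 3) * (Real.log (3 * v ^ 2 - ca v * cc v) - Real.log (3 * v ^ 2 + ca v * cc v))

lemma hasDerivAt_widthPrimitive {v : ℝ} (hv : v ∈ Ioo (-2 : ℝ) (-2 / 3)) :
    HasDerivAt widthPrimitive (-(1 + v) / 2 * (2 * Real.arctan (cc v) / ca v) +
      (-(2 + 3 * v) / 3 - 1) * (3 * v ^ 2 / (ca v * cc v * (1 + 2 * v + 3 * v ^ 2)))) v := by
  have hvc := Ioo_subset_Icc_self hv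
  have ha := ca_pos hv
  have hc := cc_pos hv
  have ha2 := ca_sq hvc
  have hc2 := cc_sq hvc
  have hN := normSq_pos v
  have hlt := ca_mul_cc_lt hvc
  have hv0 : v ≠ 0 := (nonvanishing hv).1
  have hac : 0 < ca v * cc v := mul_pos ha hc
  have hda := hasDerivAt_ca hv
  have hdc := hasDerivAt_cc hv
  have hdp : HasDerivAt (fun r => ca r * cc r)
      (-(1 + v) / ca v * cc v + ca v * ((1 + 3 * v) / cc v)) v := hda.mul hdc
  have hdr : HasDerivAt (fun r : ℝ => 3 * r ^ 2) (6 * v) v := by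
    convert! ((hasDerivAt_id v).pow 2).const_mul 3 using 1
    simp
    ring
  have h1 := (hdr.sub hdp).log (by simp only [Pi.sub_apply]; linarith)
  have h2 := (hdr.add hdp).log (by simp only [Pi.add_apply]; positivity)
  have h3 := (hda.mul hdc.arctan).sub ((h1.sub h2).const_mul (1 / 3))
  convert! h3 using 1
  simp only [Pi.sub_apply, Pi.add_apply]
  have hn : 1 + cc v ^ 2 = 1 + 2 * v + 3 * v ^ 2 := by rw [hc2]; ring
  rw [hn]
  -- The two logarithms combine because `(3 v²)² - (a c)² = 4 v² (1 + 2 v + 3 v²)`.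
  have hlog : (6 * v - (-(1 + v) / ca v * cc v + ca v * ((1 + 3 * v) / cc v))) /
        (3 * v ^ 2 - ca v * cc v) -
      (6 * v + (-(1 + v) / ca v * cc v + ca v * ((1 + 3 * v) / cc v))) /
        (3 * v ^ 2 + ca v * cc v) =
      -6 * v * (1 + v) / (ca v * cc v * (1 + 2 * v + 3 * v ^ 2)) := by
    have e1 : -(1 + v) / ca v * cc v + ca v * ((1 + 3 * v) / cc v) =
        -v * (4 + 12 * v + 6 * v ^ 2) / (ca v * cc v) := by
      rw [eq_div_iff hac.ne']
      field_simp
      rw [ha2, hc2]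
      ring
    have e2 : (3 * v ^ 2 - ca v * cc v) * (3 * v ^ 2 + ca v * cc v) =
        4 * v ^ 2 * (1 + 2 * v + 3 * v ^ 2) := by
      linear_combination (-cc v ^ 2) * ha2 + v * (2 + v) * hc2
    have e3 : (ca v * cc v) ^ 2 = -v ^ 2 * ((2 + v) * (2 + 3 * v)) := by
      rw [mul_pow, ha2, hc2]; ring
    rw [e1, div_sub_div _ _ (sub_pos.2 hlt).ne' (by positivity), e2]
    have h4 : 1 + v * 2 + v ^ 2 * 3 ≠ 0 := by nlinarith
    field_simp
    linear_combination 12 * e3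
  rw [hlog]
  have e4 : ca v * (1 / (1 + 2 * v + 3 * v ^ 2) * ((1 + 3 * v) / cc v)) =
      -v * (2 + v) * (1 + 3 * v) / (ca v * cc v * (1 + 2 * v + 3 * v ^ 2)) := by
    rw [← ha2]
    field_simp
  rw [mul_add, e4]
  field_simp
  ring

lemma continuousOn_widthPrimitive : ContinuousOn widthPrimitive (Icc (-2 : ℝ) (-2 / 3)) := by
  have hca := continuous_ca
  have hcc := continuous_cc
  refine ContinuousOn.sub (by fun_prop) (ContinuousOn.mul continuousOn_const
    (ContinuousOn.sub (ContinuousOn.log (by fun_prop) fun v hv => ?_)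
      (ContinuousOn.log (by fun_prop) fun v hv => ?_)))
  · linarith [ca_mul_cc_lt hv]
  · have h0 : v ≠ 0 := by have := hv.2; intro h; linarith
    have := mul_nonneg (ca_nonneg v) (cc_nonneg v)
    positivity

lemma integrableOn_Ioo_continuous_mul {f g : ℝ → ℝ} {a b : ℝ} (hf : IntegrableOn f (Ioo a b))
    (hg : Continuous g) : IntegrableOn (fun x => g x * f x) (Ioo a b) := by
  rw [← integrableOn_Icc_iff_integrableOn_Ioo] at hf ⊢
  exact hf.continuousOn_mul hg.continuousOn isCompact_Icc

/-- The integrand is the sum of the curvature density, half the edge integrand `α ds`, and the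
derivative of `widthPrimitive`, which contributes nothing. -/
lemma integral_widthIntegrand :
    ∫ v in Ioo (-2 : ℝ) (-2 / 3), widthIntegrand v =
      Real.pi / Real.sqrt 2 + Real.pi * arcsec 3 / 2 := by
  set f₁ : ℝ → ℝ := fun v => 2 * Real.arctan (cc v) / ca v with hf₁
  set f₂ : ℝ → ℝ := fun v => 3 * v ^ 2 / (ca v * cc v * (1 + 2 * v + 3 * v ^ 2)) with hf₂
  obtain ⟨i1, v1⟩ : IntegrableOn f₁ (Ioo (-2 : ℝ) (-2 / 3)) ∧
    ∫ v in Ioo (-2 : ℝ) (-2 / 3), f₁ v = _ := edgeMinus_substitution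
  obtain ⟨i2, v2⟩ : IntegrableOn f₂ (Ioo (-2 : ℝ) (-2 / 3)) ∧
    ∫ v in Ioo (-2 : ℝ) (-2 / 3), f₂ v = _ := integral_curvature
  have i3 : IntegrableOn (fun v => -(1 + v) / 2 * f₁ v + (-(2 + 3 * v) / 3 - 1) * f₂ v)
      (Ioo (-2 : ℝ) (-2 / 3)) :=
    (integrableOn_Ioo_continuous_mul i1 (by fun_prop)).add
      (integrableOn_Ioo_continuous_mul i2 (by fun_prop))
  have v3 : ∫ v in Ioo (-2 : ℝ) (-2 / 3),
      (-(1 + v) / 2 * f₁ v + (-(2 + 3 * v) / 3 - 1) * f₂ v) = 0 := by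
    have hab : (-2 : ℝ) ≤ -2 / 3 := by norm_num
    rw [← integral_Ioc_eq_integral_Ioo, ← intervalIntegral.integral_of_le hab,
      intervalIntegral.integral_eq_sub_of_hasDerivAt_of_le hab continuousOn_widthPrimitive
        (fun v hv => hasDerivAt_widthPrimitive hv)
        ((intervalIntegrable_iff_integrableOn_Ioo_of_le hab).2 i3)]
    have e1 : cc (-2 / 3) = 0 := by rw [cc]; norm_num
    have e2 : ca (-2) = 0 := by rw [ca]; norm_num
    -- At either end `ca v * cc v = 0`, and the two logarithms cancel.
    simp [widthPrimitive, e1, e2]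
  have hcongr : EqOn widthIntegrand (fun v => (-(1 + v) / 2 * f₁ v +
      (-(2 + 3 * v) / 3 - 1) * f₂ v) + (1 / 2 * f₁ v + f₂ v)) (Ioo (-2 : ℝ) (-2 / 3)) := by
    intro v hv
    have hvc := Ioo_subset_Icc_self hv
    have ha := ca_pos hv
    have hc := cc_pos hv
    have hN := normSq_pos v
    have hn : 1 + cc v ^ 2 = 1 + 2 * v + 3 * v ^ 2 := by rw [cc_sq hvc]; ring
    have e1 : cc v / (1 + cc v ^ 2) =
        v * (2 + 3 * v) / (cc v * (1 + 2 * v + 3 * v ^ 2)) := by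
      rw [hn, ← cc_sq hvc]
      field_simp
    simp only [widthIntegrand, hf₁, hf₂]
    rw [e1]
    field_simp
    ring
  have i4 : IntegrableOn (fun v => 1 / 2 * f₁ v + f₂ v) (Ioo (-2 : ℝ) (-2 / 3)) :=
    (i1.const_mul (1 / 2)).add i2
  rw [setIntegral_congr_fun measurableSet_Ioo hcongr, integral_add i3 i4, v3,
    integral_add (i1.const_mul (1 / 2)) i2, integral_const_mul, v1, v2]
  ring

lemma hasDerivAt_arcsin_radial {r : ℝ} (hr : r ∈ Ioo (-1 : ℝ) 1) :
    HasDerivAt (fun r => (Real.arcsin r - r * Real.sqrt (1 - r ^ 2) * (1 - 2 * r ^ 2)) / 8)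
      (r ^ 2 * Real.sqrt (1 - r ^ 2)) r := by
  have hpos : 0 < 1 - r ^ 2 := by nlinarith [hr.1, hr.2]
  have hs2 : Real.sqrt (1 - r ^ 2) ^ 2 = 1 - r ^ 2 := Real.sq_sqrt hpos.le
  have hs0 : 0 < Real.sqrt (1 - r ^ 2) := Real.sqrt_pos.2 hpos
  have hp : HasDerivAt (fun r : ℝ => r ^ 2) (2 * r) r := by
    simpa using hasDerivAt_pow 2 r
  have h1 := (Real.hasDerivAt_arcsin hr.1.ne' hr.2.ne)
  have h2 := ((hasDerivAt_id r).mul ((hp.const_sub 1).sqrt hpos.ne')).mul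
    ((hp.const_mul 2).const_sub 1)
  have h3 := (h1.sub h2).div_const 8
  convert! h3 using 1
  simp only [id, Pi.mul_apply]
  set w := Real.sqrt (1 - r ^ 2)
  field_simp
  have h4 : r ^ 2 = 1 - w ^ 2 := by linarith
  rw [h4]
  ring

/-- The integral of `r²` times the height, at distance `r` from the axis, of the part of the unit
ball that lies below the cone `z = k r`. -/
lemma integral_radial {k : ℝ} (hk : 0 ≤ k) :
    ∫ r in Ioo (0 : ℝ) 1, r ^ 2 * min (r * k) (Real.sqrt (1 - r ^ 2)) =
      (Real.arctan k + k / (1 + k ^ 2)) / 8 := by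
  -- The two terms of the minimum agree at `r₀ = 1 / √(1 + k²)`.
  set r₀ := 1 / Real.sqrt (1 + k ^ 2) with hr₀
  have hs2 : Real.sqrt (1 + k ^ 2) ^ 2 = 1 + k ^ 2 := Real.sq_sqrt (by positivity)
  have hs0 : 0 < Real.sqrt (1 + k ^ 2) := Real.sqrt_pos.2 (by positivity)
  have hr0 : 0 < r₀ := by positivity
  have hr2 : r₀ ^ 2 = 1 / (1 + k ^ 2) := by rw [hr₀, div_pow, hs2, one_pow]
  have hr2' : r₀ ^ 2 * (1 + k ^ 2) = 1 := by
    rw [hr2, one_div, inv_mul_cancel₀ (by positivity)]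
  have hr1 : r₀ ≤ 1 := by
    rw [hr₀, div_le_one hs0]
    exact Real.one_le_sqrt.2 (by nlinarith [sq_nonneg k])
  have hcont : Continuous fun r : ℝ => r ^ 2 * min (r * k) (Real.sqrt (1 - r ^ 2)) := by fun_prop
  rw [← integral_Ioc_eq_integral_Ioo, ← intervalIntegral.integral_of_le zero_le_one,
    ← intervalIntegral.integral_add_adjacent_intervals (hcont.intervalIntegrable 0 r₀)
      (hcont.intervalIntegrable r₀ 1)]
  have h1 : ∫ r in (0 : ℝ)..r₀, r ^ 2 * min (r * k) (Real.sqrt (1 - r ^ 2)) =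
      k * r₀ ^ 4 / 4 := by
    have hcongr : ∫ r in (0 : ℝ)..r₀, r ^ 2 * min (r * k) (Real.sqrt (1 - r ^ 2)) =
        ∫ r in (0 : ℝ)..r₀, k * r ^ 3 := by
      refine intervalIntegral.integral_congr fun r hr => ?_
      rw [uIcc_of_le hr0.le] at hr
      have hle : r * k ≤ Real.sqrt (1 - r ^ 2) := by
        refine Real.le_sqrt_of_sq_le ?_
        have : r ^ 2 ≤ r₀ ^ 2 := pow_le_pow_left₀ hr.1 hr.2 2
        nlinarith [mul_le_mul_of_nonneg_right this (by positivity : 0 ≤ 1 + k ^ 2)]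
      rw [min_eq_left hle]
      ring
    rw [hcongr, intervalIntegral.integral_const_mul, integral_pow]
    norm_num
    ring
  have h2 : ∫ r in r₀..1, r ^ 2 * min (r * k) (Real.sqrt (1 - r ^ 2)) =
      (Real.pi / 2 - Real.arcsin r₀ + r₀ * (r₀ * k) * (1 - 2 * r₀ ^ 2)) / 8 := by
    have hcongr : ∫ r in r₀..1, r ^ 2 * min (r * k) (Real.sqrt (1 - r ^ 2)) =
        ∫ r in r₀..1, r ^ 2 * Real.sqrt (1 - r ^ 2) := by
      refine intervalIntegral.integral_congr fun r hr => ?_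
      rw [uIcc_of_le hr1] at hr
      have hge : Real.sqrt (1 - r ^ 2) ≤ r * k := by
        have h0 : 0 ≤ r := hr0.le.trans hr.1
        refine Real.sqrt_le_iff.2 ⟨by positivity, ?_⟩
        have : r₀ ^ 2 ≤ r ^ 2 := pow_le_pow_left₀ hr0.le hr.1 2
        nlinarith [mul_le_mul_of_nonneg_right this (by positivity : 0 ≤ 1 + k ^ 2)]
      rw [min_eq_right hge]
    rw [hcongr, intervalIntegral.integral_eq_sub_of_hasDerivAt_of_le hr1
      (f := fun r => (Real.arcsin r - r * Real.sqrt (1 - r ^ 2) * (1 - 2 * r ^ 2)) / 8)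
      (by
        have := Real.continuous_arcsin
        fun_prop)
      (fun r hr => hasDerivAt_arcsin_radial ⟨by linarith [hr.1], hr.2⟩)
      (Continuous.intervalIntegrable (by fun_prop) _ _)]
    have h3 : Real.sqrt (1 - r₀ ^ 2) = r₀ * k := by
      rw [show 1 - r₀ ^ 2 = (r₀ * k) ^ 2 by rw [mul_pow]; linarith]
      exact Real.sqrt_sq (by positivity)
    rw [h3]
    norm_num
    ring
  have h3 : Real.pi / 2 - Real.arcsin r₀ = Real.arctan k := by
    rw [hr₀, ← Real.cos_arctan]
    change Real.arccos _ = _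
    refine Real.arccos_cos (Real.arctan_nonneg.2 hk) ?_
    linarith [Real.arctan_lt_pi_div_two k, Real.pi_pos]
  rw [h1, h2, h3]
  have h4 : k / (1 + k ^ 2) = k * r₀ ^ 2 := by rw [hr2]; ring
  rw [h4]
  ring

/-! ### From the sphere to the ball -/

/-- For a positively homogeneous function of degree one, the integral over the unit ball of `E3` is
a quarter of the integral over the sphere. -/
lemma integral_ball_of_homogeneous {f : E3 → ℝ}
    (hf : ∀ (r : ℝ) (x : E3), 0 < r → f (r • x) = r * f x) :
    ∫ x in Metric.ball (0 : E3) 1, f x =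
      (∫ v : Metric.sphere (0 : E3) 1, f v ∂((volume : Measure E3).toSphere)) / 4 := by
  set h : ℝ → ℝ := (Iio (1 : ℝ)).indicator id with hh
  calc
    ∫ x in Metric.ball (0 : E3) 1, f x
      = ∫ x, (Metric.ball (0 : E3) 1).indicator f x := (integral_indicator measurableSet_ball).symm
    _ = ∫ x : ({(0)}ᶜ : Set E3), (Metric.ball (0 : E3) 1).indicator f x
          ∂((volume : Measure E3).comap (↑)) := by
      rw [integral_subtype_comap (measurableSet_singleton _).compl
        fun x => (Metric.ball (0 : E3) 1).indicator f x, restrict_compl_singleton]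
    _ = ∫ x : Metric.sphere (0 : E3) 1 × Ioi (0 : ℝ), f x.1 * h x.2
          ∂((volume : Measure E3).toSphere.prod
            (Measure.volumeIoiPow (Module.finrank ℝ E3 - 1))) := by
      rw [← (Measure.measurePreserving_homeomorphUnitSphereProd
        (volume : Measure E3)).integral_comp (Homeomorph.measurableEmbedding _)]
      refine integral_congr_ae (Filter.Eventually.of_forall fun x => ?_)
      have hx : (x : E3) ≠ 0 := x.2
      have hx0 : 0 < ‖(x : E3)‖ := norm_pos_iff.2 hx
      simp only [homeomorphUnitSphereProd_apply_fst_coe, homeomorphUnitSphereProd_apply_snd_coe, hh]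
      by_cases hlt : ‖(x : E3)‖ < 1
      · rw [indicator_of_mem (by simpa using hlt), indicator_of_mem (by simpa using hlt),
          hf _ _ (inv_pos.2 hx0)]
        simp only [id]
        field_simp
      · rw [indicator_of_notMem (by simpa using hlt), indicator_of_notMem (by simpa using hlt),
          mul_zero]
    _ = (∫ v : Metric.sphere (0 : E3) 1, f v ∂((volume : Measure E3).toSphere)) *
          ∫ r : Ioi (0 : ℝ), h r ∂(Measure.volumeIoiPow (Module.finrank ℝ E3 - 1)) :=
      integral_prod_mul (fun v : Metric.sphere (0 : E3) 1 => f v) (fun r : Ioi (0 : ℝ) => h r)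
    _ = _ := by
      have hdim : Module.finrank ℝ E3 - 1 = 2 := by simp
      rw [hdim, div_eq_mul_inv]
      congr 1
      simp only [Measure.volumeIoiPow, ENNReal.ofReal]
      rw [integral_withDensity_eq_integral_smul
          (measurable_subtype_coe.pow_const _).real_toNNReal,
        integral_subtype_comap measurableSet_Ioi fun a : ℝ => Real.toNNReal (a ^ 2) • h a,
        setIntegral_congr_fun (g := (Iio (1 : ℝ)).indicator fun r => r ^ 3) measurableSet_Ioi
          fun r hr => ?_,
        setIntegral_indicator measurableSet_Iio, Ioi_inter_Iio, ← integral_Ioc_eq_integral_Ioo,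
        ← intervalIntegral.integral_of_le zero_le_one, integral_pow]
      · norm_num
      · simp only [hh, NNReal.smul_def, smul_eq_mul]
        rw [Real.coe_toNNReal _ (by positivity), indicator_apply, indicator_apply]
        split_ifs
        · simp only [id]; ring
        · simp

lemma supp_smul {r : ℝ} (hr : 0 < r) (n : E3) : supp (r • n) = r * supp n := by
  have h : ∀ x y : ℝ, Real.sqrt ((r * x) ^ 2 + (r * y) ^ 2) = r * Real.sqrt (x ^ 2 + y ^ 2) := by
    intro x y
    rw [mul_pow, mul_pow, ← mul_add, Real.sqrt_mul (by positivity), Real.sqrt_sq hr.le]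
  simp only [supp, suppMinus, suppPlus, PiLp.smul_apply, smul_eq_mul, h]
  rw [mul_max_of_nonneg _ _ hr.le, mul_sub, mul_add]

lemma integrableOn_ball_of_continuous {f : E3 → ℝ} (hf : Continuous f) :
    IntegrableOn f (Metric.ball (0 : E3) 1) :=
  (hf.continuousOn.integrableOn_compact (isCompact_closedBall 0 1)).mono_set
    Metric.ball_subset_closedBall

/-- Integrals over the ball are invariant under linear isometries. -/
lemma setIntegral_ball_comp {e : E3 ≃ₗᵢ[ℝ] E3} (f : E3 → ℝ) :
    ∫ x in Metric.ball (0 : E3) 1, f (e x) = ∫ x in Metric.ball (0 : E3) 1, f x := by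
  have h := (e.measurePreserving).setIntegral_preimage_emb
    e.toHomeomorph.measurableEmbedding f (Metric.ball (0 : E3) 1)
  rw [← h]
  congr 2
  ext x
  simp

lemma meanWidth_eq_integral_ball :
    meanWidth body = 2 / Real.pi * ∫ x in Metric.ball (0 : E3) 1, supp x := by
  have h1 := integral_ball_of_homogeneous (f := width body) fun r x hr => by
    rw [width_body, width_body, ← smul_neg, supp_smul hr, supp_smul hr]
    ring
  have h2 : ∫ x in Metric.ball (0 : E3) 1, width body x =
      2 * ∫ x in Metric.ball (0 : E3) 1, supp x := by
    simp only [width_body]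
    have hneg : IntegrableOn (fun x => supp (-x)) (Metric.ball (0 : E3) 1) :=
      integrableOn_ball_of_continuous (continuous_supp.comp continuous_neg)
    have heq : ∫ x in Metric.ball (0 : E3) 1, supp (-x) = ∫ x in Metric.ball (0 : E3) 1, supp x :=
      setIntegral_ball_comp (e := LinearIsometryEquiv.neg ℝ) supp
    rw [integral_add (integrableOn_ball_of_continuous continuous_supp) hneg, heq]
    ring
  have h3 : (volume : Measure E3).toSphere.real univ = 4 * Real.pi := by
    rw [Measure.toSphere_real_apply_univ, measureReal_def, EuclideanSpace.volume_ball_fin_three]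
    simp
    rw [ENNReal.toReal_ofReal (by positivity)]
    ring
  rw [meanWidth, average_eq, h3, smul_eq_mul]
  rw [h2] at h1
  have := Real.pi_ne_zero
  field_simp
  linarith

/-- The isometry that exchanges the two disks. -/
noncomputable def exchange : E3 ≃ₗᵢ[ℝ] E3 :=
  LinearIsometry.toLinearIsometryEquiv
    { toFun := fun x => mk3 (x 2) (-x 1) (x 0)
      map_add' := fun x y => by
        refine ext_E3 rfl ?_ rfl
        simp only [mk3_one, PiLp.add_apply]
        ring
      map_smul' := fun r x => by
        refine ext_E3 rfl ?_ rfl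
        simp
      norm_map' := fun x => by
        rw [← sq_eq_sq₀ (norm_nonneg _) (norm_nonneg _)]
        change ‖mk3 (x 2) (-x 1) (x 0)‖ ^ 2 = _
        rw [norm_sq_E3, norm_sq_E3]
        simp only [mk3_zero, mk3_one, mk3_two]
        ring } rfl

lemma exchange_apply (x : E3) : exchange x = mk3 (x 2) (-x 1) (x 0) := rfl

lemma suppMinus_exchange (x : E3) : suppMinus (exchange x) = suppPlus x := by
  simp only [exchange_apply, suppMinus, suppPlus, mk3_zero, mk3_one]
  rw [neg_sq, add_comm (x 2 ^ 2)]
  ring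

lemma suppPlus_exchange (x : E3) : suppPlus (exchange x) = suppMinus x := by
  simp only [exchange_apply, suppMinus, suppPlus, mk3_two, mk3_one]
  rw [neg_sq, add_comm (x 1 ^ 2)]
  ring

/-- The weight of `x` in a decomposition of `max x y` that treats both arguments alike. -/
noncomputable def maxWeight (x y : ℝ) : ℝ := if y < x then 1 else if x < y then 0 else 1 / 2

lemma max_eq_maxWeight (x y : ℝ) : max x y = maxWeight x y * x + maxWeight y x * y := by
  rcases lt_trichotomy x y with h | h | h
  · simp [maxWeight, h, h.le, h.not_gt]
  · subst h
    simp [maxWeight]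
    ring
  · simp [maxWeight, h, h.le, h.not_gt]

lemma measurable_maxWeight : Measurable (Function.uncurry maxWeight) :=
  Measurable.ite (measurableSet_lt measurable_snd measurable_fst) measurable_const
    (Measurable.ite (measurableSet_lt measurable_fst measurable_snd) measurable_const
      measurable_const)

lemma maxWeight_mem_Icc (x y : ℝ) : maxWeight x y ∈ Icc (0 : ℝ) 1 := by
  unfold maxWeight
  split_ifs <;> norm_num

/-- The support function of `diskMinus`, cut off where `diskPlus` reaches further. -/
noncomputable def cutSupp (x : E3) : ℝ := maxWeight (suppMinus x) (suppPlus x) * suppMinus x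

lemma measurable_cutSupp : Measurable cutSupp :=
  (measurable_maxWeight.comp
    (continuous_suppMinus.measurable.prodMk continuous_suppPlus.measurable)).mul
    continuous_suppMinus.measurable

lemma integrableOn_cutSupp : IntegrableOn cutSupp (Metric.ball (0 : E3) 1) := by
  refine (integrableOn_ball_of_continuous continuous_suppMinus.norm).mono'
    measurable_cutSupp.aestronglyMeasurable (Filter.Eventually.of_forall fun x => ?_)
  obtain ⟨h0, h1⟩ := maxWeight_mem_Icc (suppMinus x) (suppPlus x)
  rw [cutSupp, norm_mul, Real.norm_of_nonneg h0]
  exact mul_le_of_le_one_left (norm_nonneg _) h1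

/-- The maximum of two functions that `exchange` swaps is the sum of a cut-off copy of one of them
and its image. -/
lemma integral_supp_eq :
    ∫ x in Metric.ball (0 : E3) 1, supp x = 2 * ∫ x in Metric.ball (0 : E3) 1, cutSupp x := by
  have h : ∀ x, supp x = cutSupp x + cutSupp (exchange x) := fun x => by
    rw [supp, max_eq_maxWeight, cutSupp, cutSupp, suppMinus_exchange, suppPlus_exchange]
  simp only [h]
  have hi : IntegrableOn (fun x => cutSupp (exchange x)) (Metric.ball (0 : E3) 1) := by
    have h := (exchange.measurePreserving.integrableOn_comp_preimage
      exchange.toHomeomorph.measurableEmbedding (f := cutSupp)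
      (s := Metric.ball (0 : E3) 1)).2 integrableOn_cutSupp
    convert! h using 1
    ext x
    simp
  rw [integral_add integrableOn_cutSupp hi, setIntegral_ball_comp]
  ring

/-! ### Spherical integration in polar coordinates -/

/-- The coordinates `((y, x), z)` on `E3`. -/
noncomputable def coords : E3 ≃ᵐ (ℝ × ℝ) × ℝ :=
  (MeasurableEquiv.toLp 2 (Fin 3 → ℝ)).symm.trans
    ((MeasurableEquiv.piFinSuccAbove (fun _ => ℝ) 1).trans
      (((MeasurableEquiv.refl ℝ).prodCongr (MeasurableEquiv.piFinTwo fun _ => ℝ)).trans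
        MeasurableEquiv.prodAssoc.symm))

lemma coords_apply (x : E3) : coords x = ((x 1, x 0), x 2) := rfl

lemma measurePreserving_coords : MeasurePreserving coords :=
  (EuclideanSpace.volume_preserving_symm_measurableEquiv_toLp (Fin 3)).trans
    ((volume_preserving_piFinSuccAbove (fun _ => ℝ) 1).trans
      (((MeasurePreserving.id (volume : Measure ℝ)).prod
        (volume_preserving_piFinTwo fun _ => ℝ)).trans
          (volume_preserving_prodAssoc (α₁ := ℝ) (β₁ := ℝ) (γ₁ := ℝ)).symm))

/-- `cutSupp`, restricted to the unit ball, in the coordinates `((y, x), z)`. -/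
noncomputable def coordCutSupp (p : (ℝ × ℝ) × ℝ) : ℝ :=
  (Metric.ball (0 : E3) 1).indicator cutSupp (mk3 p.1.2 p.1.1 p.2)

lemma coordCutSupp_coords (x : E3) :
    coordCutSupp (coords x) = (Metric.ball (0 : E3) 1).indicator cutSupp x := by
  rw [coordCutSupp, coords_apply]
  congr 1
  exact ext_E3 rfl rfl rfl

lemma integrable_coordCutSupp : Integrable coordCutSupp := by
  rw [← measurePreserving_coords.integrable_comp_emb coords.measurableEmbedding]
  have h : coordCutSupp ∘ coords = (Metric.ball (0 : E3) 1).indicator cutSupp :=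
    funext coordCutSupp_coords
  rw [h]
  exact integrableOn_cutSupp.integrable_indicator measurableSet_ball

/-- In cylindrical coordinates around the `z`-axis, `diskMinus` reaches further than `diskPlus`
inside the double cone `|z| < ρ * cc (cos θ - 1)`. If `cos θ > 1/3`, then `cc` is the square root of
a nonpositive number and vanishes, as it should: there `diskPlus` always reaches further. -/
lemma maxWeight_polar {ρ θ c : ℝ} (hρ : 0 < ρ)
    (hc : |c| ≠ ρ * cc (Real.cos θ - 1)) :
    maxWeight (suppMinus (mk3 (ρ * Real.sin θ) (ρ * Real.cos θ) c))
        (suppPlus (mk3 (ρ * Real.sin θ) (ρ * Real.cos θ) c)) =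
      if |c| < ρ * cc (Real.cos θ - 1) then 1 else 0 := by
  set β := Real.cos θ with hβ
  have hβ1 : β ≤ 1 := Real.cos_le_one θ
  have h1 : suppMinus (mk3 (ρ * Real.sin θ) (ρ * β) c) = ρ * (1 - β) := by
    have : (ρ * Real.sin θ) ^ 2 + (ρ * β) ^ 2 = ρ ^ 2 := by
      rw [mul_pow, mul_pow, hβ, ← mul_add, Real.sin_sq_add_cos_sq, mul_one]
    rw [suppMinus, mk3_zero, mk3_one, this, Real.sqrt_sq hρ.le]
    ring
  have h2 : suppPlus (mk3 (ρ * Real.sin θ) (ρ * β) c) =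
      Real.sqrt ((ρ * β) ^ 2 + c ^ 2) + ρ * β := rfl
  have hk : cc (β - 1) = Real.sqrt ((1 - β) * (1 - 3 * β)) := by
    rw [cc]; congr 1; ring
  rw [h1, h2]
  rcases lt_or_gt_of_ne hc with h | h
  · rw [if_pos h]
    have hk0 : 0 < cc (β - 1) := by
      have := (abs_nonneg c).trans_lt h
      exact pos_of_mul_pos_right this hρ.le
    have hpos : 0 < (1 - β) * (1 - 3 * β) := by rwa [hk, Real.sqrt_pos] at hk0
    have hβ3 : 0 < 1 - 3 * β := pos_of_mul_pos_right hpos (by linarith)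
    have hc2 : c ^ 2 < ρ ^ 2 * ((1 - β) * (1 - 3 * β)) := by
      rw [← sq_abs c, ← Real.sq_sqrt hpos.le, ← hk, ← mul_pow]
      exact pow_lt_pow_left₀ h (abs_nonneg c) two_ne_zero
    have : Real.sqrt ((ρ * β) ^ 2 + c ^ 2) < ρ * (1 - 2 * β) := by
      rw [Real.sqrt_lt' (mul_pos hρ (by linarith))]
      linarith
    rw [maxWeight, if_pos (by linarith)]
  · rw [if_neg h.not_gt]
    have hc2 : ρ ^ 2 * ((1 - β) * (1 - 3 * β)) < c ^ 2 := by
      rw [← sq_abs c]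
      rcases le_total 0 ((1 - β) * (1 - 3 * β)) with h' | h'
      · rw [← Real.sq_sqrt h', ← hk, ← mul_pow]
        exact pow_lt_pow_left₀ h (mul_nonneg hρ.le (cc_nonneg _)) two_ne_zero
      · have hpos : 0 < |c| := (mul_nonneg hρ.le (cc_nonneg _)).trans_lt h
        exact (mul_nonpos_of_nonneg_of_nonpos (by positivity) h').trans_lt (by positivity)
    have : ρ * (1 - 2 * β) < Real.sqrt ((ρ * β) ^ 2 + c ^ 2) := by
      apply Real.lt_sqrt_of_sq_lt
      linarith
    rw [maxWeight, if_neg (by linarith), if_pos (by linarith)]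

/-- Where `diskMinus` reaches further, its support function `ρ (1 - cos θ)` does not depend on the
height `c`, so that the integral is this value times the length of an interval. -/
lemma integral_coordCutSupp_polar {ρ θ : ℝ} (hρ : 0 < ρ) :
    ∫ c, coordCutSupp ((ρ * Real.cos θ, ρ * Real.sin θ), c) =
      2 * ρ * (1 - Real.cos θ) *
        min (ρ * cc (Real.cos θ - 1)) (Real.sqrt (1 - ρ ^ 2)) := by
  set m := min (ρ * cc (Real.cos θ - 1)) (Real.sqrt (1 - ρ ^ 2)) with hm
  have hm0 : 0 ≤ m := le_min (mul_nonneg hρ.le (cc_nonneg _)) (Real.sqrt_nonneg _)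
  have hae : (fun c => coordCutSupp ((ρ * Real.cos θ, ρ * Real.sin θ), c)) =ᵐ[volume]
      (Ioo (-m) m).indicator fun _ => ρ * (1 - Real.cos θ) := by
    have hfin : ({ρ * cc (Real.cos θ - 1), -(ρ * cc (Real.cos θ - 1))} : Set ℝ).Finite :=
      Set.toFinite _
    filter_upwards [hfin.countable.ae_notMem volume] with c hc
    have hc' : |c| ≠ ρ * cc (Real.cos θ - 1) := by
      intro h
      apply hc
      rcases abs_choice c with h' | h'
      · left; rw [← h, h']
      · right; rw [mem_singleton_iff, ← h, h', neg_neg]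
    have hball : mk3 (ρ * Real.sin θ) (ρ * Real.cos θ) c ∈ Metric.ball (0 : E3) 1 ↔
        |c| < Real.sqrt (1 - ρ ^ 2) := by
      rw [mem_ball_zero_iff, Real.lt_sqrt (abs_nonneg c), sq_abs,
        ← sq_lt_one_iff₀ (norm_nonneg _), norm_sq_E3]
      simp only [mk3_zero, mk3_one, mk3_two]
      have := Real.sin_sq_add_cos_sq θ
      have h2 : (ρ * Real.sin θ) ^ 2 + (ρ * Real.cos θ) ^ 2 = ρ ^ 2 := by
        linear_combination ρ ^ 2 * this
      rw [h2]
      constructor <;> intro h <;> linarith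
    have h1 : suppMinus (mk3 (ρ * Real.sin θ) (ρ * Real.cos θ) c) = ρ * (1 - Real.cos θ) := by
      have : (ρ * Real.sin θ) ^ 2 + (ρ * Real.cos θ) ^ 2 = ρ ^ 2 := by
        rw [mul_pow, mul_pow, ← mul_add, Real.sin_sq_add_cos_sq, mul_one]
      rw [suppMinus, mk3_zero, mk3_one, this, Real.sqrt_sq hρ.le]
      ring
    have hmem : c ∈ Ioo (-m) m ↔
        |c| < ρ * cc (Real.cos θ - 1) ∧ |c| < Real.sqrt (1 - ρ ^ 2) := by
      rw [mem_Ioo, ← abs_lt, hm, lt_min_iff]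
    have hcut : cutSupp (mk3 (ρ * Real.sin θ) (ρ * Real.cos θ) c) =
        (if |c| < ρ * cc (Real.cos θ - 1) then 1 else 0) * (ρ * (1 - Real.cos θ)) := by
      rw [cutSupp, maxWeight_polar hρ hc', h1]
    change (Metric.ball (0 : E3) 1).indicator cutSupp
      (mk3 (ρ * Real.sin θ) (ρ * Real.cos θ) c) = _
    by_cases hb : |c| < Real.sqrt (1 - ρ ^ 2)
    · rw [indicator_of_mem (hball.2 hb), hcut]
      by_cases hk : |c| < ρ * cc (Real.cos θ - 1)
      · rw [if_pos hk, indicator_of_mem (hmem.2 ⟨hk, hb⟩), one_mul]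
      · rw [if_neg hk, indicator_of_notMem (fun h => hk (hmem.1 h).1), zero_mul]
    · rw [indicator_of_notMem (fun h => hb (hball.1 h)),
        indicator_of_notMem (fun h => hb (hmem.1 h).2)]
  rw [integral_congr_ae hae, integral_indicator measurableSet_Ioo, setIntegral_const, smul_eq_mul,
    Measure.real, Real.volume_Ioo, ENNReal.toReal_ofReal (by linarith)]
  ring

/-- The angular density of the integral of `cutSupp` over the ball. -/
noncomputable def angularDensity (β : ℝ) : ℝ :=
  (1 - β) * (Real.arctan (cc (β - 1)) + cc (β - 1) / (1 + cc (β - 1) ^ 2)) / 4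

lemma continuous_angularDensity : Continuous angularDensity := by
  have := continuous_cc
  unfold angularDensity
  have h : ∀ β : ℝ, 1 + cc (β - 1) ^ 2 ≠ 0 := fun β => by positivity
  fun_prop (disch := exact h _)

lemma integral_cutSupp_eq_polar :
    ∫ x in Metric.ball (0 : E3) 1, cutSupp x =
      ∫ θ in Ioo (-Real.pi) Real.pi, angularDensity (Real.cos θ) := by
  set F : ℝ → ℝ → ℝ := fun ρ θ =>
    ρ ^ 2 * min (ρ * cc (Real.cos θ - 1)) (Real.sqrt (1 - ρ ^ 2)) * (2 * (1 - Real.cos θ)) with hF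
  have hFcont : Continuous (Function.uncurry F) := by
    have := continuous_cc
    simp only [hF, Function.uncurry_def]
    fun_prop
  have hFint : Integrable (Function.uncurry F)
      ((volume.restrict (Ioo (0 : ℝ) 1)).prod (volume.restrict (Ioo (-Real.pi) Real.pi))) := by
    rw [Measure.prod_restrict]
    refine (hFcont.continuousOn.integrableOn_compact
      ((isCompact_Icc (a := (0 : ℝ)) (b := 1)).prod
        (isCompact_Icc (a := -Real.pi) (b := Real.pi)))).mono_set ?_
    exact prod_mono Ioo_subset_Icc_self Ioo_subset_Icc_self
  calc
    ∫ x in Metric.ball (0 : E3) 1, cutSupp x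
      = ∫ x, coordCutSupp (coords x) := by
        simp only [coordCutSupp_coords]
        rw [integral_indicator measurableSet_ball]
    _ = ∫ p, coordCutSupp p := measurePreserving_coords.integral_comp' _
    _ = ∫ q : ℝ × ℝ, ∫ c, coordCutSupp (q, c) := by
        rw [Measure.volume_eq_prod, integral_prod _ integrable_coordCutSupp]
    _ = ∫ p in polarCoord.target, p.1 • ∫ c, coordCutSupp (polarCoord.symm p, c) :=
        (integral_comp_polarCoord_symm fun q => ∫ c, coordCutSupp (q, c)).symm
    _ = ∫ p in Ioi (0 : ℝ) ×ˢ Ioo (-Real.pi) Real.pi, Function.uncurry F p := by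
        refine setIntegral_congr_fun (measurableSet_Ioi.prod measurableSet_Ioo) fun p hp => ?_
        obtain ⟨ρ, θ⟩ := p
        have hρ : 0 < ρ := hp.1
        simp only [polarCoord_symm_apply, integral_coordCutSupp_polar hρ, smul_eq_mul,
          Function.uncurry, hF]
        ring
    _ = ∫ p in Ioo (0 : ℝ) 1 ×ˢ Ioo (-Real.pi) Real.pi, Function.uncurry F p := by
        refine setIntegral_eq_of_subset_of_forall_sdiff_eq_zero
          (measurableSet_Ioi.prod measurableSet_Ioo)
          (prod_mono Ioo_subset_Ioi_self Subset.rfl) fun p hp => ?_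
        obtain ⟨ρ, θ⟩ := p
        obtain ⟨⟨h1, h2⟩, h3⟩ := hp
        have hρ0 : 0 < ρ := h1
        have hρ : 1 ≤ ρ := by
          by_contra! hlt
          exact h3 ⟨⟨h1, hlt⟩, h2⟩
        have hs : Real.sqrt (1 - ρ ^ 2) = 0 := Real.sqrt_eq_zero_of_nonpos (by nlinarith)
        simp only [Function.uncurry, hF]
        rw [hs, min_eq_right (mul_nonneg hρ0.le (cc_nonneg _))]
        ring
    _ = ∫ ρ in Ioo (0 : ℝ) 1, ∫ θ in Ioo (-Real.pi) Real.pi, F ρ θ := by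
        rw [Measure.volume_eq_prod, ← Measure.prod_restrict, integral_prod _ hFint]
        rfl
    _ = ∫ θ in Ioo (-Real.pi) Real.pi, ∫ ρ in Ioo (0 : ℝ) 1, F ρ θ :=
        integral_integral_swap hFint
    _ = ∫ θ in Ioo (-Real.pi) Real.pi, angularDensity (Real.cos θ) := by
        refine integral_congr_ae (Filter.Eventually.of_forall fun θ => ?_)
        simp only [hF]
        rw [integral_mul_const, integral_radial (cc_nonneg _), angularDensity]
        ring

lemma integral_cos_eq (f : ℝ → ℝ) (hf : Continuous f) :
    ∫ θ in Ioo (-Real.pi) Real.pi, f (Real.cos θ) =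
      2 * ∫ θ in Ioo (0 : ℝ) Real.pi, f (Real.cos θ) := by
  have hi : ∀ a b, IntervalIntegrable (fun θ => f (Real.cos θ)) volume a b := fun a b =>
    (hf.comp Real.continuous_cos).intervalIntegrable a b
  rw [← integral_Ioc_eq_integral_Ioo, ← integral_Ioc_eq_integral_Ioo,
    ← intervalIntegral.integral_of_le (by linarith [Real.pi_pos]),
    ← intervalIntegral.integral_of_le Real.pi_pos.le,
    ← intervalIntegral.integral_add_adjacent_intervals (hi (-Real.pi) 0) (hi 0 Real.pi)]
  have h := intervalIntegral.integral_comp_neg (a := 0) (b := Real.pi)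
    fun θ => f (Real.cos θ)
  simp only [Real.cos_neg, neg_zero] at h
  rw [← h]
  ring

/-- The substitution `v = cos θ - 1`; the range `-2/3 ≤ v < 0` contributes nothing, because `cc`
vanishes there. -/
lemma integral_angularDensity :
    ∫ θ in Ioo (0 : ℝ) Real.pi, angularDensity (Real.cos θ) =
      (∫ v in Ioo (-2 : ℝ) (-2 / 3), widthIntegrand v) / 4 := by
  set f : ℝ → ℝ := fun θ => Real.cos θ - 1 with hf
  have hderiv : ∀ θ ∈ Ioo (0 : ℝ) Real.pi,
      HasDerivWithinAt f (-Real.sin θ) (Ioo 0 Real.pi) θ := fun θ _ =>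
    ((Real.hasDerivAt_cos θ).sub_const 1).hasDerivWithinAt
  have hinj : InjOn f (Ioo 0 Real.pi) := by
    intro x hx y hy hxy
    exact Real.injOn_cos (Ioo_subset_Icc_self hx) (Ioo_subset_Icc_self hy)
      (by simpa [hf] using hxy)
  have himage : f '' Ioo 0 Real.pi = Ioo (-2) 0 := by
    apply Subset.antisymm
    · rintro _ ⟨θ, hθ, rfl⟩
      have hs := Real.sin_pos_of_mem_Ioo hθ
      have h1 := Real.sin_sq_add_cos_sq θ
      have h2 : (Real.cos θ) ^ 2 < 1 := by nlinarith
      have h3 := abs_lt.1 ((sq_lt_one_iff_abs_lt_one _).1 h2)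
      simp only [hf]
      constructor <;> linarith [h3.1, h3.2]
    · rintro v ⟨h1, h2⟩
      refine ⟨Real.arccos (v + 1), ⟨Real.arccos_pos.2 (by linarith), ?_⟩, ?_⟩
      · rw [Real.arccos_lt_pi]
        linarith
      · simp only [hf]
        rw [Real.cos_arccos (by linarith) (by linarith)]
        ring
  have h := integral_image_eq_integral_abs_deriv_smul measurableSet_Ioo hderiv hinj
    widthIntegrand
  rw [himage] at h
  have hcongr : EqOn (fun θ => |-Real.sin θ| • widthIntegrand (f θ))
      (fun θ => 4 * angularDensity (Real.cos θ)) (Ioo 0 Real.pi) := by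
    intro θ hθ
    have hs := Real.sin_pos_of_mem_Ioo hθ
    have ha : ca (f θ) = Real.sin θ := by
      rw [ca, Real.sqrt_eq_iff_mul_self_eq_of_pos hs]
      simp only [hf]
      linear_combination Real.sin_sq_add_cos_sq θ
    simp only [smul_eq_mul]
    rw [abs_neg, abs_of_pos hs, widthIntegrand, ha, angularDensity]
    simp only [hf]
    field_simp
    ring
  rw [setIntegral_congr_fun measurableSet_Ioo hcongr, integral_const_mul] at h
  have hzero : ∫ v in Ioo (-2 : ℝ) 0, widthIntegrand v =
      ∫ v in Ioo (-2 : ℝ) (-2 / 3), widthIntegrand v := by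
    refine setIntegral_eq_of_subset_of_forall_sdiff_eq_zero measurableSet_Ioo
      (Ioo_subset_Ioo_right (by norm_num)) fun v hv => ?_
    obtain ⟨⟨h1, h2⟩, h3⟩ := hv
    have hge : -2 / 3 ≤ v := by
      by_contra! hlt
      exact h3 ⟨h1, hlt⟩
    have hc : cc v = 0 := Real.sqrt_eq_zero_of_nonpos (by nlinarith)
    simp [widthIntegrand, hc]
  linarith

lemma meanWidth_body : meanWidth body = Real.sqrt 2 + arcsec 3 := by
  rw [meanWidth_eq_integral_ball, integral_supp_eq, integral_cutSupp_eq_polar,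
    integral_cos_eq _ continuous_angularDensity, integral_angularDensity, integral_widthIntegrand]
  have h2 : Real.sqrt 2 ^ 2 = 2 := Real.sq_sqrt zero_le_two
  have h20 : Real.sqrt 2 ≠ 0 := by positivity
  have := Real.pi_ne_zero
  field_simp
  linear_combination (-4) * h2

/-! ### Numerical bounds -/

lemma antitone_cos_terms {x : ℝ} (h : x ^ 2 ≤ 2) :
    Antitone fun n : ℕ => x ^ (2 * n) / (2 * n).factorial := by
  refine antitone_nat_of_succ_le fun n => ?_
  have h1 : (2 * (n + 1)).factorial = (2 * n + 2) * ((2 * n + 1) * (2 * n).factorial) := by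
    rw [show 2 * (n + 1) = 2 * n + 1 + 1 by ring, Nat.factorial_succ, Nat.factorial_succ]
  have hf : (0 : ℝ) < (2 * n).factorial := by exact_mod_cast Nat.factorial_pos _
  have hx : 0 ≤ x ^ (2 * n) := by rw [pow_mul]; positivity
  rw [div_le_div_iff₀ (by exact_mod_cast Nat.factorial_pos _) hf, h1]
  push_cast
  have h2 : x ^ (2 * (n + 1)) = x ^ (2 * n) * x ^ 2 := by ring
  rw [h2]
  have h3 : x ^ 2 ≤ (2 * n + 2) * (2 * n + 1) := by
    have : (0 : ℝ) ≤ n := Nat.cast_nonneg n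
    nlinarith
  have := mul_le_mul_of_nonneg_left h3 (mul_nonneg hx hf.le)
  linarith

lemma tendsto_cos_series (x : ℝ) :
    Filter.Tendsto (fun n => ∑ i ∈ Finset.range n, (-1) ^ i * (x ^ (2 * i) / (2 * i).factorial))
      Filter.atTop (nhds (Real.cos x)) := by
  have h := (Real.hasSum_cos x).tendsto_sum_nat
  refine h.congr fun n => Finset.sum_congr rfl fun i _ => ?_
  rw [mul_div_assoc]

/-- Even partial sums of the cosine series are lower bounds where the terms decrease. -/
lemma sum_le_cos {x : ℝ} (h : x ^ 2 ≤ 2) (k : ℕ) :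
    ∑ i ∈ Finset.range (2 * k), (-1) ^ i * (x ^ (2 * i) / (2 * i).factorial) ≤ Real.cos x :=
  (antitone_cos_terms h).alternating_series_le_tendsto (tendsto_cos_series x) k

/-- Odd partial sums of the cosine series are upper bounds where the terms decrease. -/
lemma cos_le_sum {x : ℝ} (h : x ^ 2 ≤ 2) (k : ℕ) :
    Real.cos x ≤ ∑ i ∈ Finset.range (2 * k + 1), (-1) ^ i * (x ^ (2 * i) / (2 * i).factorial) :=
  (antitone_cos_terms h).tendsto_le_alternating_series (tendsto_cos_series x) k

/-- A bound with 29 decimals. It follows by comparing cosines, and sixteen terms of the cosine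
series are precise enough for that. -/
lemma lt_arcsec_three : 1.23095941734077468213492917820 < arcsec 3 := by
  set q : ℝ := 1.23095941734077468213492917820 with hq
  have h1 : (3 : ℝ)⁻¹ < Real.cos q := by
    refine lt_of_lt_of_le ?_ (sum_le_cos (by rw [hq]; norm_num) 8)
    simp only [Finset.sum_range_succ, Finset.sum_range_zero, Nat.factorial, hq]
    norm_num
  have h2 : Real.arccos (Real.cos q) = q :=
    Real.arccos_cos (by rw [hq]; norm_num) (by rw [hq]; linarith [Real.pi_gt_three])
  rw [arcsec, ← h2]
  exact Real.arccos_lt_arccos (by norm_num) h1 (Real.cos_le_one q)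

lemma arcsec_three_lt : arcsec 3 < 1.23095941734077468213492917900 := by
  set q : ℝ := 1.23095941734077468213492917900 with hq
  have h1 : Real.cos q < (3 : ℝ)⁻¹ := by
    refine lt_of_le_of_lt (cos_le_sum (by rw [hq]; norm_num) 8) ?_
    simp only [Finset.sum_range_succ, Finset.sum_range_zero, Nat.factorial, hq]
    norm_num
  have h2 : Real.arccos (Real.cos q) = q :=
    Real.arccos_cos (by rw [hq]; norm_num) (by rw [hq]; linarith [Real.pi_gt_three])
  rw [arcsec, ← h2]
  exact Real.arccos_lt_arccos (Real.neg_one_le_cos q) h1 (by norm_num)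

lemma lt_sqrt_two : 1.41421356237309504880168872420 < Real.sqrt 2 := by
  rw [Real.lt_sqrt (by norm_num)]
  norm_num

lemma sqrt_two_lt : Real.sqrt 2 < 1.41421356237309504880168872500 := by
  rw [Real.sqrt_lt' (by norm_num)]
  norm_num

lemma lt_meanWidth_body : 2.6451729797138697309366179 < meanWidth body := by
  rw [meanWidth_body]
  linarith [lt_arcsec_three, lt_sqrt_two]

lemma meanWidth_body_lt : meanWidth body < 2.6451729797138697309366180 := by
  rw [meanWidth_body]
  linarith [arcsec_three_lt, sqrt_two_lt]

end TwoDisks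

theorem mainTheorem3 :
    -- the disks touch at precisely one point
    TwoDisks.diskMinus ∩ TwoDisks.diskPlus = {0} ∧
    -- the mean width
    MeasureTheory.Integrable
      (fun v : Metric.sphere (0 : TwoDisks.E3) 1 => TwoDisks.width TwoDisks.body (v : TwoDisks.E3))
      ((MeasureTheory.volume : MeasureTheory.Measure TwoDisks.E3).toSphere) ∧
    TwoDisks.meanWidth TwoDisks.body = Real.sqrt 2 + TwoDisks.arcsec 3 ∧
    2.6451729797138697309366179 < TwoDisks.meanWidth TwoDisks.body ∧
    TwoDisks.meanWidth TwoDisks.body < 2.6451729797138697309366180 ∧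
    -- the four patches parametrize the boundary, and the oriented normals are exterior normals
    (∀ s t : ℤˣ,
      (fun q : ℝ × ℝ => TwoDisks.patch s t q.1 q.2) '' TwoDisks.closedRect =
        frontier TwoDisks.body ∩ {p | 0 ≤ TwoDisks.sgn s * p 0 ∧ 0 ≤ TwoDisks.sgn t * p 2} ∧
      Set.InjOn (fun q : ℝ × ℝ => TwoDisks.patch s t q.1 q.2) TwoDisks.openRect ∧
      ∀ u ∈ Set.Icc (0 : ℝ) 1, ∀ v ∈ Set.Ioo (-2 : ℝ) (-2 / 3),
        TwoDisks.IsExteriorUnitNormal TwoDisks.body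
          (TwoDisks.patch s t u v) (TwoDisks.patchNormal s t u v)) ∧
    -- the integrated mean curvature
    (∀ s t : ℤˣ, MeasureTheory.IntegrableOn (TwoDisks.curvatureDensity s t) TwoDisks.openRect) ∧
    TwoDisks.integratedMeanCurvature = 2 * Real.sqrt 2 * Real.pi ∧
    -- the four edges, which contain all singular boundary points
    (∀ s : ℤˣ, TwoDisks.edgeMinus s =
      {p | p 0 ^ 2 + (p 1 + 1) ^ 2 = 1 ∧ p 2 = 0 ∧ 0 ≤ TwoDisks.sgn s * p 0 ∧ p 1 ≤ -2 / 3}) ∧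
    (∀ t : ℤˣ, TwoDisks.edgePlus t =
      {p | (p 1 - 1) ^ 2 + p 2 ^ 2 = 1 ∧ p 0 = 0 ∧ 0 ≤ TwoDisks.sgn t * p 2 ∧ 2 / 3 ≤ p 1}) ∧
    (∀ p ∈ frontier TwoDisks.body,
      (∀ s : ℤˣ, p ∉ TwoDisks.edgeMinus s) → (∀ t : ℤˣ, p ∉ TwoDisks.edgePlus t) →
        ∃! n : TwoDisks.E3, TwoDisks.IsExteriorUnitNormal TwoDisks.body p n) ∧
    -- the edge term
    (∀ s : ℤˣ, MeasureTheory.IntegrableOn (TwoDisks.edgeMinusDensity s)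
      (Set.Ioo (-2 : ℝ) (-2 / 3))) ∧
    (∀ t : ℤˣ, MeasureTheory.IntegrableOn (TwoDisks.edgePlusDensity t)
      (Set.Ioo (-2 : ℝ) (-2 / 3))) ∧
    4 * (∫ v in Set.Ioo (-2 : ℝ) (-2 / 3), TwoDisks.edgeMinusDensity 1 v) =
      4 * Real.pi * TwoDisks.arcsec 3 ∧
    TwoDisks.edgeTerm = 4 * Real.pi * TwoDisks.arcsec 3 ∧
    -- the mean width from the integrated mean curvature and the edge term
    TwoDisks.meanWidth TwoDisks.body =
      1 / (2 * Real.pi) * TwoDisks.integratedMeanCurvature +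
        1 / (4 * Real.pi) * TwoDisks.edgeTerm := by
  open TwoDisks in
  refine ⟨diskMinus_inter_diskPlus, integrable_width_body, meanWidth_body, lt_meanWidth_body,
    meanWidth_body_lt, fun s t => ⟨patch_image s t, patch_injOn s t, fun u hu v hv => ?_⟩,
    integrableOn_curvatureDensity, integratedMeanCurvature_eq, edgeMinus_eq, edgePlus_eq,
    fun p hp h1 h2 => existsUnique_normal hp h1 h2, integrableOn_edgeMinusDensity,
    integrableOn_edgePlusDensity, ?_, edgeTerm_eq, ?_⟩
  · rw [TwoDisks.patchNormal_eq s t hu hv]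
    exact TwoDisks.isExteriorUnitNormal_ruleNormal (Set.Ioo_subset_Icc_self hv)
  · rw [TwoDisks.integral_edgeMinusDensity]
    ring
  · rw [TwoDisks.meanWidth_body, TwoDisks.integratedMeanCurvature_eq, TwoDisks.edgeTerm_eq]
    have := Real.pi_ne_zero
    field_simp
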